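/- **Setting.** Let $H$ be a finite-dimensional complex Hilbert space, $\mathcal M\subseteq L(H)$ a finite set of self-adjoint operators, and $\mathcal A=\langle\mathcal M\rangle$ the smallest set of operators that contains $\mathcal M$ and is closed under sums, products, scalar multiples and adjoints (it need not contain $I$). Put $H_0=\bigcap_{T\in\mathcal A}\ker T$. "Projection" means orthogonal projection; "spectral projections" of a normal operator are its eigenprojections for the *nonzero* eigenvalues. Projections $P,Q$ are *reflecting* with coefficient $\lambda\in\mathbb R$ if $PQP=\lambda P$ and $QPQ=\lambda Q$. *Scattering* nonzero $P,Q$ replaces $P$ by the spectral projections $P^{(\lambda)}$ of $PQP$ together with $P-\sum_{\lambda\ne0}P^{(\lambda)}$ if this is nonzero, and $Q$ likewise using $QPQ$. **Algorithm** (all choices are arbitrary). 1. Start with the set $V$ of all spectral projections of the elements of $\mathcal M$. Mark pairs of distinct elements of $V$ as "unknown", except possibly for some reflecting ones. 2. While there are unknown pairs, choose one, $\{P,Q\}$, and scatter it. Afterwards a pair of distinct elements of the new $V$ is unknown unless both elements result from this scattering, or both were in $V$ before and their pair was not unknown, or they result from (or are) two elements of the old $V$ whose pair was not unknown and whose product is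 $0$. 3. When no pair is unknown, let $G$ be the graph on $V$ in which distinct $P,Q$ are joined iff $PQ\neq0$. For a walk $v=(P_1,\dots,P_n)$ in $G$ let $S_v=P_1\cdots P_n/\sqrt{\lambda_{12}\cdots\lambda_{n-1,n}}$ with $\lambda_{j,j+1}$ the reflection coefficients. If there are walks $v,u$ with the same initial and the same final vertices and $S_v\not\propto S_u$, choose such a pair, add the spectral projections of $S_vS_u^\dagger$ to $V$, mark the pairs formed by one of these and an element of the connected component of $v$ as unknown (no other pair), and return to step 2. 4. Otherwise choose a largest pairwise orthogonal subset $\mathcal S\subseteq V$. For each $P\in V\setminus\mathcal S$ in turn, in any order: if $I_{\mathcal S}P\ne P$, where $I_{\mathcal S}$ is the sum of the current $\mathcal S$, add $\tilde P=\frac1c(I-I_{\mathcal S})P(I-I_{\mathcal S})$, with $c\ne0$ such that $\tilde P$ is a projection, to $\mathcal S$ and to $V$. 5. For the resulting $V$, with its graph $G$ as in step 3: for each connected component $q$ of $G$ choose a largest pairwise orthogonal set of vertices $\{\Pi^q_k\}_k$ of $q$, one element $\Pi^q_{k_1}$ of it, an orthonormal basis $\{e^q_{ik_1}\}_i$ of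 the range of $\Pi^q_{k_1}$ and, for each $k\ne k_1$, a walk $v$ from $\Pi^q_k$ to $\Pi^q_{k_1}$; put $e^q_{ik}=S_v e^q_{ik_1}$. Output the table $(e^q_{ik})$. **Theorem.** Every run of the algorithm on $\mathcal M$ can be carried out (no step ever asks for an object that does not exist) and stops after finitely many steps. Whatever choices are made, every block of the output has at least one row and one column, the vectors $e^q_{ik}$ form an orthonormal basis of $H_0^\perp$ (so an orthonormal basis of $H$ if $H_0=0$), and, with $H_{A_q}$, $H_{B_q}$ the spaces with orthonormal bases $\{a^q_i\}_i$, $\{b^q_k\}_k$, the isometric isomorphism $$V:H\to\Big[\bigoplus_q H_{A_q}\otimes H_{B_q}\Big]\oplus H_0,\qquad Ve^q_{ik}=a^q_i\otimes b^q_k,\quad V|_{H_0}=\mathrm{id},$$ realises the Wedderburn (irrep) decomposition of $\mathcal A$: an operator $T\in L(H)$ belongs to $\mathcal A$ if and only if $VTV^{-1}=\big[\bigoplus_q I_{A_q}\otimes M_{B_q}\big]\oplus0$ for some operators $M_{B_q}\in L(H_{B_q})$. -/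

import Mathlib

/-! Irrep decomposition of a finite-dimensional matrix algebra by scattering of projections:
the algorithm as a nondeterministic transition system, and the Wedderburn decomposition
that its output has to realise. -/

open scoped TensorProduct

namespace IrrepDecomp

noncomputable section

open scoped Classical

variable {H : Type*} [NormedAddCommGroup H] [InnerProductSpace ℂ H] [FiniteDimensional ℂ H]

/-! ### Spectral projections and scattering -/

/-- The orthogonal projection of `H` onto the eigenspace of `T` at `μ`. -/
def eigenProj (T : H →ₗ[ℂ] H) (μ : ℂ) : H →ₗ[ℂ] H :=
  ((Module.End.eigenspace T μ).starProjection : H →L[ℂ] H)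

theorem finite_spectralProjections (T : H →ₗ[ℂ] H) :
    (eigenProj T '' {μ : ℂ | Module.End.HasEigenvalue T μ ∧ μ ≠ 0}).Finite :=
  Set.Finite.image _ ((Module.End.finite_hasEigenvalue T).subset fun _ h => h.1)

/-- The spectral projections of a (normal) operator that belong to its nonzero eigenvalues. -/
def spectralProjections (T : H →ₗ[ℂ] H) : Finset (H →ₗ[ℂ] H) :=
  (finite_spectralProjections T).toFinset

/-- The null projection left over from `P` when `P` is scattered with `Q`. -/
def nullProj (P Q : H →ₗ[ℂ] H) : H →ₗ[ℂ] H :=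
  P - ∑ R ∈ spectralProjections (P * Q * P), R

/-- The nonzero projections into which `P` breaks when it is scattered with `Q`. -/
def scatterParts (P Q : H →ₗ[ℂ] H) : Finset (H →ₗ[ℂ] H) :=
  (insert (nullProj P Q) (spectralProjections (P * Q * P))).erase 0

/-- `P` and `Q` reflect with reflection coefficient `l`. -/
def ReflectWith (P Q : H →ₗ[ℂ] H) (l : ℝ) : Prop :=
  P * Q * P = (l : ℂ) • P ∧ Q * P * Q = (l : ℂ) • Q

/-- `P` and `Q` are reflecting. -/
def Reflecting (P Q : H →ₗ[ℂ] H) : Prop := ∃ l : ℝ, ReflectWith P Q l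

/-- The reflection coefficient of a reflecting pair (unique if `P ≠ 0`). -/
def reflCoeff (P Q : H →ₗ[ℂ] H) : ℝ := Classical.epsilon (ReflectWith P Q)

/-! ### Reflection networks -/

/-- An improper reflection network: a finite set of projections, together with the set of those
pairs whose relation is not yet known to be reflecting (the dashed edges). For all other pairs
the relation is known: properly reflecting if the product is nonzero (solid edge), orthogonal
if it is zero (no edge). -/
structure Network (H : Type*) [NormedAddCommGroup H] [InnerProductSpace ℂ H] where
  projs : Finset (H →ₗ[ℂ] H)
  unknown : Finset (Sym2 (H →ₗ[ℂ] H))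

/-- The pairs of distinct elements of `V`. -/
def pairs (V : Finset (H →ₗ[ℂ] H)) : Finset (Sym2 (H →ₗ[ℂ] H)) :=
  V.offDiag.image fun p => s(p.1, p.2)

/-- All spectral projections of the generators. -/
def allSpectralProjections (𝓜 : Finset (H →ₗ[ℂ] H)) : Finset (H →ₗ[ℂ] H) :=
  𝓜.biUnion spectralProjections

/-- A possible initial network: all pairs are marked unknown, except for some that are
reflecting (and recognised as such). -/
def IsInitialNetwork (𝓜 : Finset (H →ₗ[ℂ] H)) (N : Network H) : Prop :=
  N.projs = allSpectralProjections 𝓜 ∧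
  N.unknown ⊆ pairs N.projs ∧
  ∀ P ∈ N.projs, ∀ Q ∈ N.projs, P ≠ Q → s(P, Q) ∉ N.unknown → Reflecting P Q

/-- The projections that replace the vertex `X` when the pair `P`, `Q` is scattered. -/
def offspring (P Q X : H →ₗ[ℂ] H) : Finset (H →ₗ[ℂ] H) :=
  if X = P then scatterParts P Q else if X = Q then scatterParts Q P else {X}

/-- After the scattering of `P`, `Q` the relation between `X` and `Y` is known if
(1) both come out of this scattering event, or
(2) both were there before (hence unbroken) and their relation was already known, or
(3) they inherit orthogonality from predecessors that were known to be orthogonal.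
All other edges become, or stay, unknown. -/
def KnownAfter (N : Network H) (P Q X Y : H →ₗ[ℂ] H) : Prop :=
  (X ∈ scatterParts P Q ∪ scatterParts Q P ∧ Y ∈ scatterParts P Q ∪ scatterParts Q P) ∨
  (X ∈ N.projs ∧ Y ∈ N.projs ∧ s(X, Y) ∉ N.unknown) ∨
  (∃ X₀ ∈ N.projs, ∃ Y₀ ∈ N.projs, X ∈ offspring P Q X₀ ∧ Y ∈ offspring P Q Y₀ ∧
    X₀ * Y₀ = 0 ∧ s(X₀, Y₀) ∉ N.unknown)

/-- The projections of the network after the scattering of its vertices `P`, `Q`. -/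
def Network.projsAfter (N : Network H) (P Q : H →ₗ[ℂ] H) : Finset (H →ₗ[ℂ] H) :=
  N.projs.biUnion (offspring P Q)

/-- The network after the scattering of its vertices `P`, `Q`. -/
def Network.scatter (N : Network H) (P Q : H →ₗ[ℂ] H) : Network H where
  projs := N.projsAfter P Q
  unknown := (pairs (N.projsAfter P Q)).filter fun z =>
    ¬ ∃ X Y, z = s(X, Y) ∧ KnownAfter N P Q X Y

/-- The graph of the proper reflection network with vertex set `V`: distinct vertices are joined
if they are not orthogonal. -/
def graph (V : Finset (H →ₗ[ℂ] H)) : SimpleGraph V :=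
  SimpleGraph.fromRel fun P Q => (P : H →ₗ[ℂ] H) * (Q : H →ₗ[ℂ] H) ≠ 0

/-- The projections in a connected component. -/
def component (V : Finset (H →ₗ[ℂ] H)) (C : (graph V).ConnectedComponent) :
    Finset (H →ₗ[ℂ] H) :=
  (Finset.univ.filter fun P : V => (graph V).connectedComponentMk P = C).image Subtype.val

/-- The product of the reflection coefficients of consecutive entries. -/
def coeffProd : List (H →ₗ[ℂ] H) → ℝ
  | P :: Q :: l => reflCoeff P Q * coeffProd (Q :: l)
  | _ => 1

/-- The path isometry of a path `v₁, …, vₙ` in a network: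
`Π_{v₁} ⋯ Π_{vₙ} / √(λ_{v₁v₂} ⋯ λ_{vₙ₋₁vₙ})`. -/
def pathIsometry {V : Finset (H →ₗ[ℂ] H)} {P Q : V} (w : (graph V).Walk P Q) : H →ₗ[ℂ] H :=
  (((√(coeffProd (w.support.map Subtype.val)))⁻¹ : ℝ) : ℂ) • (w.support.map Subtype.val).prod

/-- The path isometries along `w` and `w'` are proportional. -/
def Proportional {V : Finset (H →ₗ[ℂ] H)} {P Q : V} (w w' : (graph V).Walk P Q) : Prop :=
  ∃ c : ℂ, pathIsometry w = c • pathIsometry w'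

/-- The minimality test: path isometries depend, up to a factor, on the end points only. -/
def PathIndependent (V : Finset (H →ₗ[ℂ] H)) : Prop :=
  ∀ (P Q : V) (w w' : (graph V).Walk P Q), Proportional w w'

/-- The spectral projections of `S_w S_{w'}†`, with which a non-minimal network is broken up. -/
def loopProjections {V : Finset (H →ₗ[ℂ] H)} {P Q : V} (w w' : (graph V).Walk P Q) :
    Finset (H →ₗ[ℂ] H) :=
  spectralProjections (pathIsometry w * star (pathIsometry w'))

/-- The network in which the spectral projections of `S_w S_{w'}†` have been added, their
relations to the connected component of `w` being unknown. -/
def addLoopProjections {V : Finset (H →ₗ[ℂ] H)} {P Q : V} (w w' : (graph V).Walk P Q) :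
    Network H where
  projs := V ∪ loopProjections w w'
  unknown := (component V ((graph V).connectedComponentMk P) ×ˢ loopProjections w w').image
    fun p => s(p.1, p.2)

/-! ### Completion and the bipartition table -/

/-- The elements of `S` are pairwise orthogonal. -/
def PairwiseOrthogonal (S : Finset (H →ₗ[ℂ] H)) : Prop :=
  (S : Set (H →ₗ[ℂ] H)).Pairwise fun P Q => P * Q = 0

/-- `S` is a largest set of pairwise orthogonal elements of `V`. -/
def IsMaxIndependentSet (V S : Finset (H →ₗ[ℂ] H)) : Prop :=
  S ⊆ V ∧ PairwiseOrthogonal S ∧ ∀ T ⊆ V, PairwiseOrthogonal T → T.card ≤ S.card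

/-- The sum of the projections in `S`. -/
def sumAll (S : Finset (H →ₗ[ℂ] H)) : H →ₗ[ℂ] H := ∑ P ∈ S, P

/-- `T` is the complementary projection `c⁻¹ (I - I_S) P (I - I_S)`, `I_S` being the sum of `S`,
with the factor `c` that makes it a projection. -/
def IsComplementaryProj (S : Finset (H →ₗ[ℂ] H)) (P T : H →ₗ[ℂ] H) : Prop :=
  IsStarProjection T ∧
  ∃ c : ℂ, c ≠ 0 ∧ T = c⁻¹ • ((1 - sumAll S) * P * (1 - sumAll S))

/-- A block-diagonal table of vectors: `e q i k` stands in block `q`, row `i`, column `k`. -/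
structure BPT (H : Type*) where
  blocks : ℕ
  rows : Fin blocks → ℕ
  cols : Fin blocks → ℕ
  e : (q : Fin blocks) → Fin (rows q) → Fin (cols q) → H

/-- `B` is a possible result of the construction of the irrep basis from the network `V`: the
blocks are the connected components; the columns of a block stand for the elements of a maximum
independent set of the component; one of these columns, say `k₁`, holds an arbitrary orthonormal
basis of the range of its projection; every other column is the image of the column `k₁`
under an arbitrary path isometry. -/
def ConstructsIrrepBasis (V : Finset (H →ₗ[ℂ] H)) (B : BPT H) : Prop :=
  ∃ comp : Fin B.blocks ≃ (graph V).ConnectedComponent, ∀ q : Fin B.blocks,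
    ∃ (col : Fin (B.cols q) → V) (k₁ : Fin (B.cols q)),
      Function.Injective col ∧
      IsMaxIndependentSet (component V (comp q))
        (Finset.univ.image fun k => (col k : H →ₗ[ℂ] H)) ∧
      Orthonormal ℂ (fun i => B.e q i k₁) ∧
      Submodule.span ℂ (Set.range fun i => B.e q i k₁) =
        LinearMap.range (col k₁ : H →ₗ[ℂ] H) ∧
      ∀ k, k ≠ k₁ → ∃ w : (graph V).Walk (col k) (col k₁),
        ∀ i, B.e q i k = pathIsometry w (B.e q i k₁)

/-! ### The algorithm -/

/-- The states of the algorithm: in the scattering loop; at the minimality check of a proper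
network; in the completion loop (network, orthogonal set, projections still to be tested); before
the construction of the table; finished. -/
inductive State (H : Type*) [NormedAddCommGroup H] [InnerProductSpace ℂ H] where
  | scattering (N : Network H)
  | minimality (V : Finset (H →ₗ[ℂ] H))
  | completing (V msmp todo : Finset (H →ₗ[ℂ] H))
  | constructing (V : Finset (H →ₗ[ℂ] H))
  | output (B : BPT H)

/-- One step of the algorithm. All choices left open by the algorithm are arbitrary. -/
inductive Step : State H → State H → Prop
  | scatter (N : Network H) (P Q : H →ₗ[ℂ] H) (h : s(P, Q) ∈ N.unknown) :
      Step (.scattering N) (.scattering (N.scatter P Q))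
  | allReflecting (N : Network H) (h : N.unknown = ∅) :
      Step (.scattering N) (.minimality N.projs)
  | notMinimal (V : Finset (H →ₗ[ℂ] H)) (P Q : V) (w w' : (graph V).Walk P Q)
      (h : ¬ Proportional w w') :
      Step (.minimality V) (.scattering (addLoopProjections w w'))
  | minimal (V msmp : Finset (H →ₗ[ℂ] H)) (h : PathIndependent V)
      (hm : IsMaxIndependentSet V msmp) :
      Step (.minimality V) (.completing V msmp (V \ msmp))
  | covered (V msmp todo : Finset (H →ₗ[ℂ] H)) (P : H →ₗ[ℂ] H) (hP : P ∈ todo)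
      (h : sumAll msmp * P = P) :
      Step (.completing V msmp todo) (.completing V msmp (todo.erase P))
  | complement (V msmp todo : Finset (H →ₗ[ℂ] H)) (P T : H →ₗ[ℂ] H) (hP : P ∈ todo)
      (h : sumAll msmp * P ≠ P) (hT : IsComplementaryProj msmp P T) :
      Step (.completing V msmp todo)
        (.completing (insert T V) (insert T msmp) (todo.erase P))
  | complete (V msmp : Finset (H →ₗ[ℂ] H)) :
      Step (.completing V msmp ∅) (.constructing V)
  | construct (V : Finset (H →ₗ[ℂ] H)) (B : BPT H) (h : ConstructsIrrepBasis V B) :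
      Step (.constructing V) (.output B)

/-- The initial states of the algorithm on the input `𝓜`. -/
def Initial (𝓜 : Finset (H →ₗ[ℂ] H)) (s : State H) : Prop :=
  ∃ N, IsInitialNetwork 𝓜 N ∧ s = .scattering N

/-- The states that the algorithm can reach on the input `𝓜`. -/
def Reachable (𝓜 : Finset (H →ₗ[ℂ] H)) (s : State H) : Prop :=
  ∃ s₀, Initial 𝓜 s₀ ∧ Relation.ReflTransGen Step s₀ s

/-! ### The irrep decomposition -/

/-- The space `H₀` on which the algebra vanishes. -/
def nullSpace (A : NonUnitalStarSubalgebra ℂ (H →ₗ[ℂ] H)) : Submodule ℂ H :=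
  ⨅ T ∈ A, LinearMap.ker T

/-- The space `⨁_q H_{A_q} ⊗ H_{B_q}`, with `H_{A_q} = ℂ^{rows q}` and `H_{B_q} = ℂ^{cols q}`. -/
abbrev BPT.Space (B : BPT H) : Type :=
  PiLp 2 fun q : Fin B.blocks =>
    EuclideanSpace ℂ (Fin (B.rows q)) ⊗[ℂ] EuclideanSpace ℂ (Fin (B.cols q))

/-- The operator `⨁_q I_{A_q} ⊗ M_{B_q}`. -/
def BPT.blockOp (B : BPT H)
    (M : (q : Fin B.blocks) →
      EuclideanSpace ℂ (Fin (B.cols q)) →ₗ[ℂ] EuclideanSpace ℂ (Fin (B.cols q)))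
    (x : B.Space) : B.Space :=
  WithLp.toLp 2 fun q => (M q).lTensor (EuclideanSpace ℂ (Fin (B.rows q))) (x q)

/-- The vector `|a_i⟩ ⊗ |b_k⟩` in the summand `q`. -/
def BPT.productVector (B : BPT H) (q : Fin B.blocks) (i : Fin (B.rows q)) (k : Fin (B.cols q)) :
    B.Space :=
  WithLp.toLp 2 (Pi.single q
    (EuclideanSpace.single i (1 : ℂ) ⊗ₜ[ℂ] EuclideanSpace.single k (1 : ℂ)))

/-- The table `B` realises the irrep decomposition `H ≅ (⨁_q H_{A_q} ⊗ H_{B_q}) ⊕ H₀` of the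
algebra `A`: its entries form an orthonormal basis of the orthogonal complement of `H₀`, and under
the isometry `V` that maps `e q i k` to `a_i ⊗ b_k` in the summand `q` and is the identity on `H₀`,
the elements of `A` are exactly the operators `(⨁_q I_{A_q} ⊗ M_{B_q}) ⊕ 0`. -/
def RealisesIrrepDecomposition (A : NonUnitalStarSubalgebra ℂ (H →ₗ[ℂ] H)) (B : BPT H) : Prop :=
  (∀ q, 0 < B.rows q ∧ 0 < B.cols q) ∧
  Orthonormal ℂ
    (fun x : (q : Fin B.blocks) × (Fin (B.rows q) × Fin (B.cols q)) => B.e x.1 x.2.1 x.2.2) ∧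
  Submodule.span ℂ (Set.range
    fun x : (q : Fin B.blocks) × (Fin (B.rows q) × Fin (B.cols q)) => B.e x.1 x.2.1 x.2.2) =
      (nullSpace A)ᗮ ∧
  ∃ V : H ≃ₗᵢ[ℂ] WithLp 2 (B.Space × nullSpace A),
    (∀ q i k, V (B.e q i k) = WithLp.toLp 2 (B.productVector q i k, 0)) ∧
    (∀ v : nullSpace A, V (v : H) = WithLp.toLp 2 (0, v)) ∧
    ∀ T : H →ₗ[ℂ] H, T ∈ A ↔
      ∃ M : (q : Fin B.blocks) →
          EuclideanSpace ℂ (Fin (B.cols q)) →ₗ[ℂ] EuclideanSpace ℂ (Fin (B.cols q)),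
        ∀ x : H, V (T x) = WithLp.toLp 2 (B.blockOp M (V x).fst, 0)

end

end IrrepDecomp

/-! Correctness rests on the fact that the algebra `A` generated by the vertices never changes.
Scattering `P` and `Q` produces eigenprojections of `P Q P` and `Q P Q` for nonzero eigenvalues,
which are polynomials without constant term in these operators, and two remainders. So all parts lie
in `A`, and each old vertex is the sum of its parts. The intertwining relation `(P Q P)(P Q) = (P
Q)(Q P Q)` makes parts for different eigenvalues orthogonal and parts for the same eigenvalue
reflecting (`reflecting_of_mem_scatterParts`).

Once all pairs reflect, path isometries are partial isometries in `A`, and for `T ∈ A` the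
compression `P T Q` is a combination of path isometries from `P` to `Q`
(`ProperNetwork.conj_mem_pathSpan`). It therefore vanishes if `P` and `Q` lie in different
components. If path isometries depend only on their end points up to a factor, then `P A P = ℂ P`,
so the vertices are minimal projections of `A`. Completion adds further minimal projections until an
orthogonal set of them adds up to a unit of `A`. A trace count then shows that every largest
orthogonal set of a component adds up to the unit of that component
(`CompletionInvariant.sumAll_mul_of_isMaxIndependentSet`). The path isometries `U q k` from the
distinguished column to column `k` satisfy `star (U q k) * T * U q l ∈ ℂ E q`, so the products `U q
l * star (U q k)` are matrix units spanning `A`, and the table is a basis adapted to them.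

Termination uses a lexicographic measure on the ranges of the vertices, ordered by inclusion.
Scattering replaces subspaces by smaller ones, so the multiset of dimensions of the maximal ranges
never increases in the Dershowitz–Manna order, nor does the multiset of dimensions of all ranges; if
no range changes, the number of unknown pairs drops. Adding loop projections enlarges the network,
but only strictly below vertices that form an antichain. The maximal ranges then stay fixed and the
antichain property is lost. Scattering cannot restore this property without lowering the maximal
ranges (`Refines.antichainFlag_le`), so a flag for it, ranked between the two multisets, makes the
whole measure decrease. -/

namespace IrrepDecomp

noncomputable section

open scoped Classical

set_option linter.unusedSectionVars false

/-! ### Refinement of finite sets in a ranked order -/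

section Order

variable {α : Type*} [PartialOrder α]

/-- `W'` arises from `W` by replacing some elements by nonempty sets of smaller elements. -/
structure Refines (W' W : Finset α) : Prop where
  exists_ge : ∀ x ∈ W', ∃ y ∈ W, x ≤ y ∧ (x = y ∨ y ∉ W')
  exists_le : ∀ y ∈ W, ∃ x ∈ W', x ≤ y

/-- The maximal elements of a finite set. -/
def maxElements (W : Finset α) : Finset α := W.filter fun x => ∀ y ∈ W, x ≤ y → x = y

theorem mem_maxElements {W : Finset α} {x : α} :
    x ∈ maxElements W ↔ x ∈ W ∧ ∀ y ∈ W, x ≤ y → x = y := Finset.mem_filter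

theorem exists_le_mem_maxElements {W : Finset α} {x : α} (hx : x ∈ W) :
    ∃ z ∈ maxElements W, x ≤ z := by
  obtain ⟨z, hxz, hz⟩ := W.exists_le_maximal hx
  exact ⟨z, mem_maxElements.2 ⟨hz.1, fun y hy hzy => le_antisymm hzy (hz.2 hy hzy)⟩, hxz⟩

/-- `1` for antichains and `0` for all other finite sets. -/
def antichainFlag (W : Finset α) : ℕ := if maxElements W = W then 1 else 0

/-- The intersection supplies the common part of the two multisets; every rank added to it is
dominated by a removed one. -/
theorem dershowitzMannaLT_of_ne {f : α → ℕ} {W' W : Finset α}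
    (h : ∀ x ∈ W', x ∉ W → ∃ y ∈ W, y ∉ W' ∧ f x < f y) (hne : W' ≠ W) :
    (W'.val.map f).IsDershowitzMannaLT (W.val.map f) := by
  have hdisj : ∀ s t : Finset α, s = s ∩ t ∪ s \ t := fun s t => by
    rw [Finset.union_comm, Finset.sdiff_union_inter]
  have hval : ∀ s t : Finset α, s.val = (s ∩ t).val + (s \ t).val := fun s t => by
    rw [← Finset.disjUnion_val (s ∩ t) (s \ t) (Finset.disjoint_sdiff_inter s t).symm]
    congr 1
    rw [Finset.disjUnion_eq_union, ← hdisj]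
  refine ⟨(W' ∩ W).val.map f, (W' \ W).val.map f, (W \ W').val.map f, ?_, ?_, ?_, ?_⟩
  -- If nothing is removed, nothing can be added either, because each added element needs a removed
  -- one of larger rank.
  · intro h0
    have h0' : W \ W' = ∅ := Finset.val_eq_zero.1 (Multiset.map_eq_zero.1 h0)
    have hsub : W ⊆ W' := Finset.sdiff_eq_empty_iff_subset.1 h0'
    apply hne
    refine Finset.Subset.antisymm (fun x hx => ?_) hsub
    by_contra hxW
    obtain ⟨y, hy, hy', -⟩ := h x hx hxW
    exact hy' (hsub hy)
  · rw [← Multiset.map_add, ← hval]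
  · rw [← Multiset.map_add, Finset.inter_comm, ← hval]
  · intro y hy
    obtain ⟨x, hx, rfl⟩ := Multiset.mem_map.1 hy
    obtain ⟨hx1, hx2⟩ := Finset.mem_sdiff.1 (show x ∈ W' \ W from hx)
    obtain ⟨z, hz, hz', hlt⟩ := h x hx1 hx2
    exact ⟨f z, Multiset.mem_map.2 ⟨z, Finset.mem_sdiff.2 ⟨hz, hz'⟩, rfl⟩, hlt⟩

variable {f : α → ℕ} {W' W : Finset α}

theorem Refines.dershowitzMannaLT (h : Refines W' W) (hf : StrictMono f) (hne : W' ≠ W) :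
    (W'.val.map f).IsDershowitzMannaLT (W.val.map f) := by
  refine dershowitzMannaLT_of_ne (fun x hx hxW => ?_) hne
  obtain ⟨y, hy, hxy, rfl | hy'⟩ := h.exists_ge x hx
  · exact absurd hy hxW
  · refine ⟨y, hy, hy', hf (lt_of_le_of_ne hxy ?_)⟩
    rintro rfl
    exact hxW hy

theorem Refines.dershowitzMannaLT_maxElements (h : Refines W' W) (hf : StrictMono f)
    (hne : maxElements W' ≠ maxElements W) :
    ((maxElements W').val.map f).IsDershowitzMannaLT ((maxElements W).val.map f) := by
  refine dershowitzMannaLT_of_ne (fun x hx hxW => ?_) hne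
  obtain ⟨hx1, hx2⟩ := mem_maxElements.1 hx
  obtain ⟨y, hy, hxy, hor⟩ := h.exists_ge x hx1
  obtain ⟨z, hz, hyz⟩ := exists_le_mem_maxElements hy
  have hxz : x ≠ z := by
    rintro rfl
    exact hxW hz
  refine ⟨z, hz, fun hz' => hxz ?_, hf (lt_of_le_of_ne (hxy.trans hyz) hxz)⟩
  exact hx2 z (mem_maxElements.1 hz').1 (hxy.trans hyz)

/-- Suppose that `W'` is an antichain, and let `x ∈ W` lie below a maximal `z`. Some `x' ∈ W'` lies
below `x`; both `x'` and `z` belong to the antichain `W'`, so `x' = z` and hence `x = z`. -/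
theorem Refines.antichainFlag_le (h : Refines W' W) (he : maxElements W' = maxElements W) :
    antichainFlag W' ≤ antichainFlag W := by
  unfold antichainFlag
  split_ifs with h1 h2
  · exact le_rfl
  · exfalso
    apply h2
    refine Finset.Subset.antisymm (Finset.filter_subset _ _) fun x hx => ?_
    obtain ⟨z, hz, hxz⟩ := exists_le_mem_maxElements hx
    obtain ⟨x', hx', hle⟩ := h.exists_le x hx
    rw [← h1] at hx'
    have hz' : z ∈ W' := (mem_maxElements.1 (he ▸ hz : z ∈ maxElements W')).1
    have e := (mem_maxElements.1 hx').2 z hz' (hle.trans hxz)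
    subst e
    rwa [le_antisymm hxz hle]
  · exact Nat.zero_le _
  · exact le_rfl

/-- Needed when loop projections are added: they enter strictly below an antichain and leave the
leading term of the measure unchanged. -/
theorem maxElements_union {L : Finset α} (hW : maxElements W = W)
    (hL : ∀ x ∈ L, ∃ y ∈ W, x < y) : maxElements (W ∪ L) = W := by
  ext x
  rw [mem_maxElements, Finset.mem_union]
  constructor
  · rintro ⟨hx | hx, hmax⟩
    · exact hx
    · obtain ⟨y, hy, hlt⟩ := hL x hx
      exact absurd (hmax y (Finset.mem_union_left _ hy) hlt.le) hlt.ne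
  · intro hx
    refine ⟨Or.inl hx, fun y hy hxy => ?_⟩
    have hx' := (mem_maxElements.1 (hW.symm ▸ hx : x ∈ maxElements W)).2
    obtain hy | hy := Finset.mem_union.1 hy
    · exact hx' y hy hxy
    · obtain ⟨z, hz, hlt⟩ := hL y hy
      have := hx' z hz (hxy.trans hlt.le)
      subst this
      exact absurd hxy hlt.not_ge

end Order

variable {H : Type*} [NormedAddCommGroup H] [InnerProductSpace ℂ H] [FiniteDimensional ℂ H]

/-! ### Spectral theory of normal operators -/

theorem isStarProjection_eigenProj (T : H →ₗ[ℂ] H) (μ : ℂ) : IsStarProjection (eigenProj T μ) := by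
  refine LinearMap.isStarProjection_toContinuousLinearMap_iff.1 ?_
  exact isStarProjection_starProjection (U := Module.End.eigenspace T μ)

theorem eigenProj_apply_mem (T : H →ₗ[ℂ] H) (μ : ℂ) (x : H) :
    eigenProj T μ x ∈ Module.End.eigenspace T μ :=
  Submodule.starProjection_apply_mem _ x

theorem eigenProj_apply_of_mem {T : H →ₗ[ℂ] H} {μ : ℂ} {x : H}
    (hx : x ∈ Module.End.eigenspace T μ) : eigenProj T μ x = x :=
  Submodule.starProjection_eq_self_iff.2 hx

theorem eigenProj_ne_zero_iff {T : H →ₗ[ℂ] H} {μ : ℂ} :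
    eigenProj T μ ≠ 0 ↔ Module.End.HasEigenvalue T μ := by
  rw [Module.End.hasEigenvalue_iff, not_iff_not, Submodule.eq_bot_iff]
  constructor
  · intro h x hx
    rw [← eigenProj_apply_of_mem hx, h, LinearMap.zero_apply]
  · intro h
    ext x
    exact h _ (eigenProj_apply_mem T μ x)

theorem mul_eigenProj (T : H →ₗ[ℂ] H) (μ : ℂ) : T * eigenProj T μ = μ • eigenProj T μ := by
  ext x
  exact Module.End.mem_eigenspace_iff.1 (eigenProj_apply_mem T μ x)

theorem isStarNormal_sub_smul_one {T : H →ₗ[ℂ] H} (hT : IsStarNormal T) (μ : ℂ) :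
    IsStarNormal (T - μ • 1) := by
  have h' : star T * T = T * star T := hT.star_comm_self
  constructor
  change _ * _ = _ * _
  simp only [star_sub, star_smul, star_one, mul_sub, sub_mul, h', smul_mul_assoc, mul_smul_comm,
      one_mul, mul_one, smul_sub]
  rw [smul_comm μ (star μ)]
  abel

/-- A normal operator and its adjoint have the same kernel: with `S = T - μ`, commuting `S` and `S†`
gives `‖S† x‖² = ⟪x, S† S x⟫ = 0`. -/
theorem star_apply_of_mem_eigenspace {T : H →ₗ[ℂ] H} (hT : IsStarNormal T) {μ : ℂ} {x : H}
    (hx : x ∈ Module.End.eigenspace T μ) : (star T) x = star μ • x := by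
  have h0 : (T - μ • 1) x = 0 := by simp [Module.End.mem_eigenspace_iff.1 hx]
  have hc : (T - μ • 1) * star (T - μ • 1) = star (T - μ • 1) * (T - μ • 1) :=
    (isStarNormal_sub_smul_one hT μ).star_comm_self.symm
  have h1 : star (T - μ • 1) x = 0 := by
    rw [← inner_self_eq_zero (𝕜 := ℂ)]
    conv_lhs => rw [LinearMap.star_eq_adjoint]
    rw [LinearMap.adjoint_inner_left, ← LinearMap.star_eq_adjoint, ← Module.End.mul_apply, hc,
      Module.End.mul_apply, h0, map_zero, inner_zero_right]
  simpa [sub_eq_zero] using h1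

theorem eigenProj_mul {T : H →ₗ[ℂ] H} (hT : IsStarNormal T) (μ : ℂ) :
    eigenProj T μ * T = μ • eigenProj T μ := by
  have : star T * eigenProj T μ = star μ • eigenProj T μ := by
    ext x
    exact star_apply_of_mem_eigenspace hT (eigenProj_apply_mem T μ x)
  have h := congrArg star this
  simpa [(isStarProjection_eigenProj T μ).isSelfAdjoint.star_eq] using h

theorem eigenProj_mul_eigenProj {T : H →ₗ[ℂ] H} (hT : IsStarNormal T) {μ ν : ℂ} (h : μ ≠ ν) :
    eigenProj T μ * eigenProj T ν = 0 := by
  have h1 : eigenProj T μ * (T * eigenProj T ν) = (eigenProj T μ * T) * eigenProj T ν := by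
    rw [mul_assoc]
  rw [mul_eigenProj, eigenProj_mul hT, mul_smul_comm, smul_mul_assoc, eq_comm, ← sub_eq_zero,
    ← sub_smul] at h1
  exact (smul_eq_zero.1 h1).resolve_left (sub_ne_zero.2 h)

/-- Generalised eigenspaces always span over `ℂ`, and a normal operator has no nilpotent part: if
`S² x = 0` for `S = T - μ`, then `S x ∈ ker S = ker S†`, so `‖S x‖² = ⟪S† S x, x⟫ = 0`. -/
theorem iSup_eigenspace_eq_top {T : H →ₗ[ℂ] H} (hT : IsStarNormal T) :
    ⨆ μ, Module.End.eigenspace T μ = ⊤ := by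
  rw [← Module.End.iSup_maxGenEigenspace_eq_top T]
  congr 1
  ext1 μ
  have key : ∀ x, (T - μ • 1) ((T - μ • 1) x) = 0 → (T - μ • 1) x = 0 := by
    intro x hx
    have hmem : (T - μ • 1) x ∈ Module.End.eigenspace (T - μ • 1) 0 := by
      simpa [Module.End.mem_eigenspace_iff] using hx
    have hs := star_apply_of_mem_eigenspace (isStarNormal_sub_smul_one hT μ) hmem
    rw [star_zero, zero_smul, LinearMap.star_eq_adjoint] at hs
    rw [← inner_self_eq_zero (𝕜 := ℂ), ← LinearMap.adjoint_inner_left, hs, inner_zero_left]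
  apply le_antisymm
  · exact Module.End.eigenspace_le_maxGenEigenspace
  · intro x hx
    rw [Module.End.mem_maxGenEigenspace] at hx
    obtain ⟨k, hk⟩ := hx
    have this : (T - μ • 1) x = 0 := by
      induction k with
      | zero => rw [show x = 0 by simpa using hk, map_zero]
      | succ k ih =>
        rcases k with _ | j
        · simpa using hk
        · apply ih
          rw [pow_succ', Module.End.mul_apply]
          apply key
          rwa [← Module.End.mul_apply, ← Module.End.mul_apply, mul_assoc, ← pow_succ', ← pow_succ']
    rw [Module.End.mem_eigenspace_iff]
    simpa [sub_eq_zero] using this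

theorem ext_eigenProj {T A B : H →ₗ[ℂ] H} (hT : IsStarNormal T)
    (h : ∀ μ, A * eigenProj T μ = B * eigenProj T μ) : A = B := by
  have hle : (⊤ : Submodule ℂ H) ≤ LinearMap.eqLocus A B := by
    rw [← iSup_eigenspace_eq_top hT, iSup_le_iff]
    intro μ x hx
    have := LinearMap.congr_fun (h μ) x
    simpa [eigenProj_apply_of_mem hx] using this
  ext x
  exact hle (Submodule.mem_top (x := x))

theorem aeval_mul_eigenProj (T : H →ₗ[ℂ] H) (μ : ℂ) (p : Polynomial ℂ) :
    Polynomial.aeval T p * eigenProj T μ = p.eval μ • eigenProj T μ := by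
  induction p using Polynomial.induction_on' with
  | add p q hp hq => simp [add_mul, hp, hq, add_smul]
  | monomial n a =>
    have : T ^ n * eigenProj T μ = μ ^ n • eigenProj T μ := by
      induction n with
      | zero => simp
      | succ n ih =>
        rw [pow_succ', mul_assoc, ih, mul_smul_comm, mul_eigenProj, smul_smul, pow_succ]
    rw [Polynomial.aeval_monomial, mul_assoc, this, Polynomial.eval_monomial, mul_smul_comm,
      ← Algebra.smul_def, smul_smul, mul_comm]

theorem mul_aeval_mem {A : NonUnitalStarSubalgebra ℂ (H →ₗ[ℂ] H)} {T : H →ₗ[ℂ] H} (hA : T ∈ A)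
    (p : Polynomial ℂ) : T * Polynomial.aeval T p ∈ A := by
  induction p using Polynomial.induction_on' with
  | add p q hp hq => simpa [mul_add] using add_mem hp hq
  | monomial n a =>
    have : T * T ^ n ∈ A := by
      induction n with
      | zero => simpa using hA
      | succ n ih => rw [pow_succ, ← mul_assoc]; exact mul_mem ih hA
    rw [Polynomial.aeval_monomial, ← Algebra.smul_def, mul_smul_comm]
    exact SMulMemClass.smul_mem a this

/-- Since `A` need not contain `1`, the eigenprojection has to be a polynomial in `T` without
constant term. It is `T p(T)`, where `p` interpolates `μ⁻¹` at `μ` and `0` at all other eigenvalues;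
this is where `μ ≠ 0` enters. -/
theorem eigenProj_mem {A : NonUnitalStarSubalgebra ℂ (H →ₗ[ℂ] H)} {T : H →ₗ[ℂ] H}
    (hT : IsStarNormal T) (hA : T ∈ A) {μ : ℂ} (hμ : μ ≠ 0) : eigenProj T μ ∈ A := by
  set s : Finset ℂ := (Module.End.finite_hasEigenvalue T).toFinset with hs
  set p : Polynomial ℂ := Lagrange.interpolate s id fun ν => if ν = μ then μ⁻¹ else 0 with hp
  have : eigenProj T μ = T * Polynomial.aeval T p := by
    apply ext_eigenProj hT
    intro ν
    by_cases hν : Module.End.HasEigenvalue T ν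
    · have he : p.eval ν = if ν = μ then μ⁻¹ else 0 :=
        Lagrange.eval_interpolate_at_node _ (Set.injOn_id _)
          (by rw [hs, Set.Finite.mem_toFinset]; exact hν)
      rw [mul_assoc, aeval_mul_eigenProj, he, mul_smul_comm, mul_eigenProj]
      split_ifs with h
      · subst h
        rw [(isStarProjection_eigenProj T ν).isIdempotentElem.eq, smul_smul, inv_mul_cancel₀ hμ,
          one_smul]
      · rw [eigenProj_mul_eigenProj hT (Ne.symm h), zero_smul]
    · have : eigenProj T ν = 0 := by
        by_contra h
        exact hν (eigenProj_ne_zero_iff.1 h)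
      simp [this]
  rw [this]
  exact mul_aeval_mem hA p

/-! ### Spectral projections for the nonzero eigenvalues -/

theorem mem_spectralProjections {T R : H →ₗ[ℂ] H} :
    R ∈ spectralProjections T ↔
      ∃ μ, Module.End.HasEigenvalue T μ ∧ μ ≠ 0 ∧ eigenProj T μ = R := by
  simp [spectralProjections, and_assoc]

theorem mem_of_mem_spectralProjections {A : NonUnitalStarSubalgebra ℂ (H →ₗ[ℂ] H)}
    {T R : H →ₗ[ℂ] H} (hT : IsStarNormal T) (hA : T ∈ A) (hR : R ∈ spectralProjections T) :
    R ∈ A := by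
  obtain ⟨μ, -, hμ, rfl⟩ := mem_spectralProjections.1 hR
  exact eigenProj_mem hT hA hμ

theorem isStarProjection_of_mem_spectralProjections {T R : H →ₗ[ℂ] H}
    (hR : R ∈ spectralProjections T) : IsStarProjection R := by
  obtain ⟨μ, -, hμ, rfl⟩ := mem_spectralProjections.1 hR
  exact isStarProjection_eigenProj T μ

theorem ne_zero_of_mem_spectralProjections {T R : H →ₗ[ℂ] H}
    (hR : R ∈ spectralProjections T) : R ≠ 0 := by
  obtain ⟨μ, h, hμ, rfl⟩ := mem_spectralProjections.1 hR
  exact eigenProj_ne_zero_iff.2 h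

theorem mul_eq_zero_of_mem_spectralProjections {T R S : H →ₗ[ℂ] H} (hT : IsStarNormal T)
    (hR : R ∈ spectralProjections T) (hS : S ∈ spectralProjections T) (h : R ≠ S) :
    R * S = 0 := by
  obtain ⟨μ, -, -, rfl⟩ := mem_spectralProjections.1 hR
  obtain ⟨ν, -, -, rfl⟩ := mem_spectralProjections.1 hS
  exact eigenProj_mul_eigenProj hT fun e => h (by rw [e])

/-- The spectral decomposition of a normal operator. -/
theorem exists_eq_sum_spectralProjections {T : H →ₗ[ℂ] H} (hT : IsStarNormal T) :
    ∃ c : (H →ₗ[ℂ] H) → ℂ, T = ∑ R ∈ spectralProjections T, c R • R := by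
  -- The sum runs over projections rather than eigenvalues, so the eigenvalue is recovered from the
  -- projection; the value `0` elsewhere is never used.
  have hc : ∀ R : H →ₗ[ℂ] H, ∃ c : ℂ, R ∈ spectralProjections T → T * R = c • R := by
    intro R
    by_cases hR : R ∈ spectralProjections T
    · obtain ⟨μ, -, -, rfl⟩ := mem_spectralProjections.1 hR
      exact ⟨μ, fun _ => mul_eigenProj T μ⟩
    · exact ⟨0, fun h => absurd h hR⟩
  choose c hc using hc
  refine ⟨c, ext_eigenProj hT fun ν => ?_⟩
  rw [Finset.sum_mul]
  by_cases hν : eigenProj T ν ∈ spectralProjections T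
  · rw [Finset.sum_eq_single_of_mem _ hν, smul_mul_assoc,
      (isStarProjection_eigenProj T ν).isIdempotentElem.eq, hc _ hν]
    intro R hR hne
    rw [smul_mul_assoc, mul_eq_zero_of_mem_spectralProjections hT hR hν hne, smul_zero]
  -- An eigenprojection missing from the finite set belongs to the eigenvalue `0` or to no
  -- eigenvalue at all; `T` annihilates it in both cases.
  · have h0 : T * eigenProj T ν = 0 := by
      rw [mul_eigenProj]
      by_cases h : ν = 0
      · rw [h, zero_smul]
      · by_cases h' : Module.End.HasEigenvalue T ν
        · exact absurd (mem_spectralProjections.2 ⟨ν, h', h, rfl⟩) hν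
        · rw [not_not.1 (mt eigenProj_ne_zero_iff.1 h'), smul_zero]
    rw [h0, Finset.sum_eq_zero]
    intro R hR
    obtain ⟨μ, h1, h2, rfl⟩ := mem_spectralProjections.1 hR
    have hne : μ ≠ ν := by
      rintro rfl
      exact hν hR
    rw [smul_mul_assoc, eigenProj_mul_eigenProj hT hne, smul_zero]

theorem mem_adjoin_spectralProjections {T : H →ₗ[ℂ] H} (hT : IsStarNormal T) :
    T ∈ NonUnitalStarAlgebra.adjoin ℂ (spectralProjections T : Set (H →ₗ[ℂ] H)) := by
  obtain ⟨c, hc⟩ := exists_eq_sum_spectralProjections hT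
  have : ∑ R ∈ spectralProjections T, c R • R ∈
      NonUnitalStarAlgebra.adjoin ℂ (spectralProjections T : Set (H →ₗ[ℂ] H)) :=
    sum_mem fun R hR => SMulMemClass.smul_mem _ (NonUnitalStarAlgebra.subset_adjoin ℂ _ hR)
  rwa [← hc] at this

/-! ### Orthogonal sets of projections -/

theorem mul_eq_zero_symm {P Q : H →ₗ[ℂ] H} (hP : IsSelfAdjoint P) (hQ : IsSelfAdjoint Q)
    (h : P * Q = 0) : Q * P = 0 := by
  simpa [hP.star_eq, hQ.star_eq] using congrArg star h

theorem mul_eq_right_symm {P Q : H →ₗ[ℂ] H} (hP : IsSelfAdjoint P) (hQ : IsSelfAdjoint Q)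
    (h : P * Q = Q) : Q * P = Q := by
  simpa [hP.star_eq, hQ.star_eq] using congrArg star h

theorem sumAll_mul_of_mem {S : Finset (H →ₗ[ℂ] H)} (hS : ∀ P ∈ S, IsStarProjection P)
    (ho : PairwiseOrthogonal S) {P : H →ₗ[ℂ] H} (hP : P ∈ S) : sumAll S * P = P := by
  rw [sumAll, Finset.sum_mul, Finset.sum_eq_single_of_mem _ hP, (hS P hP).isIdempotentElem.eq]
  intro R hR hne
  exact ho hR hP hne

theorem isStarProjection_sumAll {S : Finset (H →ₗ[ℂ] H)} (hS : ∀ P ∈ S, IsStarProjection P)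
    (ho : PairwiseOrthogonal S) : IsStarProjection (sumAll S) where
  isIdempotentElem := by
    change sumAll S * sumAll S = sumAll S
    conv_lhs => rw [sumAll, Finset.mul_sum]
    rw [sumAll]
    exact Finset.sum_congr rfl fun P hP => sumAll_mul_of_mem hS ho hP
  isSelfAdjoint := by
    rw [sumAll, IsSelfAdjoint, star_sum]
    exact Finset.sum_congr rfl fun P hP => (hS P hP).isSelfAdjoint.star_eq

theorem eq_zero_of_star_mul_self {T : H →ₗ[ℂ] H} (h : star T * T = 0) : T = 0 := by
  ext x
  have h3 : inner ℂ (T x) (T x) = 0 := by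
    rw [← LinearMap.adjoint_inner_left, ← LinearMap.star_eq_adjoint, ← Module.End.mul_apply, h,
      LinearMap.zero_apply, inner_zero_left]
  simpa using h3

theorem sumAll_mem {A : NonUnitalStarSubalgebra ℂ (H →ₗ[ℂ] H)} {S : Finset (H →ₗ[ℂ] H)}
    (hS : ∀ P ∈ S, P ∈ A) : sumAll S ∈ A := sum_mem hS

/-! ### Scattering -/

section Scatter

variable {P Q : H →ₗ[ℂ] H}

theorem isSelfAdjoint_conj (hP : IsStarProjection P) (hQ : IsStarProjection Q) :
    IsSelfAdjoint (P * Q * P) := by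
  simp [IsSelfAdjoint, hP.isSelfAdjoint.star_eq, hQ.isSelfAdjoint.star_eq, mul_assoc]

theorem isStarNormal_conj (hP : IsStarProjection P) (hQ : IsStarProjection Q) :
    IsStarNormal (P * Q * P) := (isSelfAdjoint_conj hP hQ).isStarNormal

theorem eigenProj_eq_smul_mul (T : H →ₗ[ℂ] H) {μ : ℂ} (hμ : μ ≠ 0) :
    eigenProj T μ = μ⁻¹ • (T * eigenProj T μ) := by
  rw [mul_eigenProj, smul_smul, inv_mul_cancel₀ hμ, one_smul]

theorem mul_eq_of_mem_spectralProjections {T R : H →ₗ[ℂ] H} (hP : P * T = T)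
    (hR : R ∈ spectralProjections T) : P * R = R := by
  obtain ⟨μ, -, hμ, rfl⟩ := mem_spectralProjections.1 hR
  rw [eigenProj_eq_smul_mul T hμ, mul_smul_comm, ← mul_assoc, hP]

theorem pairwiseOrthogonal_spectralProjections {T : H →ₗ[ℂ] H} (hT : IsStarNormal T) :
    PairwiseOrthogonal (spectralProjections T) := fun _ hR _ hS hne =>
  mul_eq_zero_of_mem_spectralProjections hT hR hS hne

theorem mul_conj_eq (hP : IsStarProjection P) : P * (P * Q * P) = P * Q * P := by
  rw [mul_assoc P Q P, ← mul_assoc P P, hP.isIdempotentElem.eq]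

theorem mul_sumAll_spectralProjections {T : H →ₗ[ℂ] H} (h : P * T = T) :
    P * sumAll (spectralProjections T) = sumAll (spectralProjections T) := by
  rw [sumAll, Finset.mul_sum]
  exact Finset.sum_congr rfl fun R hR => mul_eq_of_mem_spectralProjections h hR

theorem isStarProjection_nullProj (hP : IsStarProjection P) (hQ : IsStarProjection Q) :
    IsStarProjection (nullProj P Q) := by
  have h := isStarProjection_sumAll
    (fun R hR => isStarProjection_of_mem_spectralProjections (T := P * Q * P) hR)
    (pairwiseOrthogonal_spectralProjections (isStarNormal_conj hP hQ))
  exact h.sub_of_mul_eq_right hP (mul_sumAll_spectralProjections (mul_conj_eq hP))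

theorem mul_nullProj (hP : IsStarProjection P) : P * nullProj P Q = nullProj P Q := by
  have := mul_sumAll_spectralProjections (mul_conj_eq (Q := Q) hP)
  rw [sumAll] at this
  rw [nullProj, mul_sub, this, hP.isIdempotentElem.eq]

theorem mem_scatterParts {R : H →ₗ[ℂ] H} : R ∈ scatterParts P Q ↔
    R ≠ 0 ∧ (R = nullProj P Q ∨ R ∈ spectralProjections (P * Q * P)) := by
  simp [scatterParts]

theorem isStarProjection_of_mem_scatterParts (hP : IsStarProjection P) (hQ : IsStarProjection Q)
    {R : H →ₗ[ℂ] H} (hR : R ∈ scatterParts P Q) : IsStarProjection R := by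
  obtain ⟨-, rfl | hR⟩ := mem_scatterParts.1 hR
  · exact isStarProjection_nullProj hP hQ
  · exact isStarProjection_of_mem_spectralProjections hR

theorem mul_of_mem_scatterParts (hP : IsStarProjection P)
    {R : H →ₗ[ℂ] H} (hR : R ∈ scatterParts P Q) : P * R = R := by
  obtain ⟨-, rfl | hR⟩ := mem_scatterParts.1 hR
  · exact mul_nullProj hP
  · exact mul_eq_of_mem_spectralProjections (mul_conj_eq hP) hR

theorem nullProj_mul_eq_zero (hP : IsStarProjection P) (hQ : IsStarProjection Q) {R : H →ₗ[ℂ] H}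
    (hR : R ∈ spectralProjections (P * Q * P)) : nullProj P Q * R = 0 := by
  have h := sumAll_mul_of_mem (S := spectralProjections (P * Q * P))
    (fun R hR => isStarProjection_of_mem_spectralProjections hR)
    (pairwiseOrthogonal_spectralProjections (isStarNormal_conj hP hQ)) hR
  rw [sumAll] at h
  rw [nullProj, sub_mul, h, mul_eq_of_mem_spectralProjections (mul_conj_eq hP) hR, sub_self]

theorem pairwiseOrthogonal_scatterParts (hP : IsStarProjection P) (hQ : IsStarProjection Q) :
    PairwiseOrthogonal (scatterParts P Q) := by
  intro R hR S hS hne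
  obtain ⟨-, rfl | hR'⟩ := mem_scatterParts.1 hR <;> obtain ⟨-, rfl | hS'⟩ := mem_scatterParts.1 hS
  · exact absurd rfl hne
  · exact nullProj_mul_eq_zero hP hQ hS'
  · exact mul_eq_zero_symm (isStarProjection_nullProj hP hQ).isSelfAdjoint
      (isStarProjection_of_mem_spectralProjections hR').isSelfAdjoint
      (nullProj_mul_eq_zero hP hQ hR')
  · exact mul_eq_zero_of_mem_spectralProjections (isStarNormal_conj hP hQ) hR' hS' hne

/-- This is why scattering loses no generator: each old vertex stays in the span of the new ones. -/
theorem sumAll_scatterParts (hP : IsStarProjection P) (hQ : IsStarProjection Q) :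
    sumAll (scatterParts P Q) = P := by
  -- Otherwise the null projection would be orthogonal to itself, hence zero, but spectral
  -- projections are nonzero.
  have h0 : nullProj P Q ∈ spectralProjections (P * Q * P) → False := by
    intro h
    have := nullProj_mul_eq_zero hP hQ h
    rw [(isStarProjection_nullProj hP hQ).isIdempotentElem.eq] at this
    exact ne_zero_of_mem_spectralProjections h this
  rw [sumAll, scatterParts, Finset.sum_erase (f := fun R => R) _ rfl, Finset.sum_insert h0,
    nullProj, sub_add_cancel]

theorem mem_of_mem_scatterParts {A : NonUnitalStarSubalgebra ℂ (H →ₗ[ℂ] H)}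
    (hP : IsStarProjection P) (hQ : IsStarProjection Q) (hPA : P ∈ A) (hQA : Q ∈ A)
    {R : H →ₗ[ℂ] H} (hR : R ∈ scatterParts P Q) : R ∈ A := by
  have key : ∀ R ∈ spectralProjections (P * Q * P), R ∈ A := fun R hR =>
    mem_of_mem_spectralProjections (isStarNormal_conj hP hQ)
      (mul_mem (mul_mem hPA hQA) hPA) hR
  obtain ⟨-, rfl | hR⟩ := mem_scatterParts.1 hR
  · exact sub_mem hPA (sum_mem key)
  · exact key R hR

/-- The null projection `N` kills the spectral projections of `P Q P`, hence `P Q P` itself. As `N =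
N P = P N`, this gives `(Q N)† (Q N) = N (P Q P) N = 0`. -/
theorem mul_nullProj_eq_zero (hP : IsStarProjection P) (hQ : IsStarProjection Q) :
    Q * nullProj P Q = 0 := by
  set N := nullProj P Q with hN
  have hNs := isStarProjection_nullProj hP hQ
  have hPN : P * N = N := mul_nullProj hP
  have hNP : N * P = N := mul_eq_right_symm hP.isSelfAdjoint hNs.isSelfAdjoint hPN
  obtain ⟨c, hc⟩ := exists_eq_sum_spectralProjections (isStarNormal_conj hP hQ)
  have h1 : N * (P * Q * P) = 0 := by
    rw [hc, Finset.mul_sum, Finset.sum_eq_zero]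
    intro R hR
    rw [mul_smul_comm, nullProj_mul_eq_zero hP hQ hR, smul_zero]
  apply eq_zero_of_star_mul_self
  rw [star_mul, hNs.isSelfAdjoint.star_eq, hQ.isSelfAdjoint.star_eq, mul_assoc, ← mul_assoc Q Q,
    hQ.isIdempotentElem.eq]
  calc N * (Q * N) = N * P * (Q * (P * N)) := by rw [hPN, hNP]
    _ = N * (P * Q * P) * N := by simp only [mul_assoc]
    _ = 0 := by rw [h1, zero_mul]

theorem reflecting_of_mul_eq_zero (hP : IsSelfAdjoint P) (hQ : IsSelfAdjoint Q) (h : P * Q = 0) :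
    Reflecting P Q := by
  refine ⟨0, ?_, ?_⟩
  · rw [h]; simp
  · rw [mul_eq_zero_symm hP hQ h]; simp

theorem Reflecting.symm (h : Reflecting P Q) : Reflecting Q P := by
  obtain ⟨l, h1, h2⟩ := h
  exact ⟨l, h2, h1⟩

theorem mul_eigenProj_conj (hP : IsStarProjection P) {μ : ℂ} (hμ : μ ≠ 0) :
    P * eigenProj (P * Q * P) μ = eigenProj (P * Q * P) μ := by
  rw [eigenProj_eq_smul_mul _ hμ, mul_smul_comm, ← mul_assoc, mul_conj_eq hP]

theorem eigenProj_conj_mul (hP : IsStarProjection P) {μ : ℂ} (hμ : μ ≠ 0) :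
    eigenProj (P * Q * P) μ * P = eigenProj (P * Q * P) μ :=
  mul_eq_right_symm hP.isSelfAdjoint (isStarProjection_eigenProj _ _).isSelfAdjoint
    (mul_eigenProj_conj hP hμ)

/-- `P Q` intertwines `Q P Q` with `P Q P`. Between the two eigenprojections `P Q` can be absorbed,
and evaluating `P Q P` on the left or `Q P Q` on the right gives the same product times `μ` and
times `ν`. -/
theorem eigenProj_conj_mul_eigenProj_conj_of_ne (hP : IsStarProjection P)
    (hQ : IsStarProjection Q) {μ ν : ℂ} (hμ : μ ≠ 0) (hν : ν ≠ 0) (hne : μ ≠ ν) :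
    eigenProj (P * Q * P) μ * eigenProj (Q * P * Q) ν = 0 := by
  have h0 : P * Q * P * (P * Q) = P * Q * (Q * P * Q) := by
    simp only [mul_assoc]
    rw [← mul_assoc P P, hP.isIdempotentElem.eq, ← mul_assoc Q Q, hQ.isIdempotentElem.eq]
  have h1 : eigenProj (P * Q * P) μ * (P * Q) * eigenProj (Q * P * Q) ν =
      eigenProj (P * Q * P) μ * eigenProj (Q * P * Q) ν := by
    rw [← mul_assoc, eigenProj_conj_mul hP hμ, mul_assoc, mul_eigenProj_conj hQ hν]
  have h2 : μ • (eigenProj (P * Q * P) μ * (P * Q) * eigenProj (Q * P * Q) ν) =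
      ν • (eigenProj (P * Q * P) μ * (P * Q) * eigenProj (Q * P * Q) ν) := by
    rw [← smul_mul_assoc, ← smul_mul_assoc, ← eigenProj_mul (isStarNormal_conj hP hQ), mul_assoc _ _
      (P * Q), h0, ← mul_smul_comm, ← mul_eigenProj]
    simp only [mul_assoc]
  rw [h1, ← sub_eq_zero, ← sub_smul] at h2
  exact (smul_eq_zero.1 h2).resolve_left (sub_ne_zero.2 hne)

/-- Here `E Q E = E (P Q P) E = μ E`. Splitting the middle `Q` into its own parts, `E` annihilates
the null projection and all parts for other eigenvalues, so only the part `F` for `μ` remains. -/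
theorem eigenProj_conj_mul_eigenProj_conj (hP : IsStarProjection P) (hQ : IsStarProjection Q)
    {μ : ℂ} (hμ : μ ≠ 0) :
    eigenProj (P * Q * P) μ * eigenProj (Q * P * Q) μ * eigenProj (P * Q * P) μ =
      μ • eigenProj (P * Q * P) μ := by
  set E := eigenProj (P * Q * P) μ with hE
  set F := eigenProj (Q * P * Q) μ with hF
  have hEP : E * P = E := eigenProj_conj_mul hP hμ
  have hPE : P * E = E := mul_eigenProj_conj hP hμ
  have h1 : E * Q * E = μ • E := by
    calc E * Q * E = E * P * Q * (P * E) := by rw [hEP, hPE]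
      _ = E * (P * Q * P * E) := by simp only [mul_assoc]
      _ = μ • E := by
        rw [hE, mul_eigenProj, mul_smul_comm, (isStarProjection_eigenProj _ _).isIdempotentElem.eq]
  have hQ' : Q = ∑ R ∈ spectralProjections (Q * P * Q), R + nullProj Q P := by
    rw [nullProj]; abel
  have hN : E * nullProj Q P = 0 := by
    rw [← hEP, mul_assoc, mul_nullProj_eq_zero hQ hP, mul_zero]
  have h2 : E * ∑ R ∈ spectralProjections (Q * P * Q), R = E * F := by
    rw [Finset.mul_sum]
    have h3 : ∀ R ∈ spectralProjections (Q * P * Q), R ≠ F → E * R = 0 := by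
      intro R hR hne
      obtain ⟨ν, -, hν, rfl⟩ := mem_spectralProjections.1 hR
      refine eigenProj_conj_mul_eigenProj_conj_of_ne hP hQ hμ hν ?_
      rintro rfl
      exact hne rfl
    refine Finset.sum_eq_single F h3 fun hF' => ?_
    by_cases h' : Module.End.HasEigenvalue (Q * P * Q) μ
    · exact absurd (mem_spectralProjections.2 ⟨μ, h', hμ, rfl⟩) hF'
    · rw [hF, not_not.1 (mt eigenProj_ne_zero_iff.1 h'), mul_zero]
  rw [← h1]
  conv_rhs => rw [hQ', mul_add, hN, add_zero, h2]

theorem reflecting_of_mem_scatterParts (hP : IsStarProjection P) (hQ : IsStarProjection Q)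
    {X Y : H →ₗ[ℂ] H} (hX : X ∈ scatterParts P Q) (hY : Y ∈ scatterParts Q P) :
    Reflecting X Y := by
  have hXs := isStarProjection_of_mem_scatterParts hP hQ hX
  have hYs := isStarProjection_of_mem_scatterParts hQ hP hY
  have hPX := mul_of_mem_scatterParts hP hX
  have hQY := mul_of_mem_scatterParts hQ hY
  have hXP := mul_eq_right_symm hP.isSelfAdjoint hXs.isSelfAdjoint hPX
  obtain ⟨-, rfl | hX'⟩ := mem_scatterParts.1 hX
  · apply reflecting_of_mul_eq_zero hXs.isSelfAdjoint hYs.isSelfAdjoint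
    apply mul_eq_zero_symm hYs.isSelfAdjoint hXs.isSelfAdjoint
    rw [← mul_eq_right_symm hQ.isSelfAdjoint hYs.isSelfAdjoint hQY, mul_assoc,
      mul_nullProj_eq_zero hP hQ, mul_zero]
  obtain ⟨-, rfl | hY'⟩ := mem_scatterParts.1 hY
  · apply reflecting_of_mul_eq_zero hXs.isSelfAdjoint hYs.isSelfAdjoint
    rw [← hXP, mul_assoc, mul_nullProj_eq_zero hQ hP, mul_zero]
  obtain ⟨μ, h, hμ, rfl⟩ := mem_spectralProjections.1 hX'
  obtain ⟨ν, -, hν, rfl⟩ := mem_spectralProjections.1 hY'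
  by_cases hne : μ = ν
  · subst hne
    -- Reflection coefficients are real by definition; the eigenvalue is real because `P Q P` is
    -- self-adjoint.
    have hreal : ((μ.re : ℝ) : ℂ) = μ := by
      apply Complex.conj_eq_iff_re.1
      exact LinearMap.IsSymmetric.conj_eigenvalue_eq_self
        ((LinearMap.isSymmetric_iff_isSelfAdjoint _).2 (isSelfAdjoint_conj hP hQ)) h
    refine ⟨μ.re, ?_, ?_⟩
    · rw [hreal]; exact eigenProj_conj_mul_eigenProj_conj hP hQ hμ
    · rw [hreal]; exact eigenProj_conj_mul_eigenProj_conj hQ hP hμ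
  · exact reflecting_of_mul_eq_zero hXs.isSelfAdjoint hYs.isSelfAdjoint
      (eigenProj_conj_mul_eigenProj_conj_of_ne hP hQ hμ hν hne)

end Scatter

/-! ### The invariant of the scattering loop -/

/-- The elements of `V` are nonzero projections, and they generate the algebra `A`. -/
structure Generates (A : NonUnitalStarSubalgebra ℂ (H →ₗ[ℂ] H)) (V : Finset (H →ₗ[ℂ] H)) :
    Prop where
  proj : ∀ P ∈ V, IsStarProjection P
  ne_zero : ∀ P ∈ V, P ≠ 0
  adjoin_eq : NonUnitalStarAlgebra.adjoin ℂ (V : Set (H →ₗ[ℂ] H)) = A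

theorem Generates.mem {A : NonUnitalStarSubalgebra ℂ (H →ₗ[ℂ] H)} {V : Finset (H →ₗ[ℂ] H)}
    (h : Generates A V) {P : H →ₗ[ℂ] H} (hP : P ∈ V) : P ∈ A := by
  rw [← h.adjoin_eq]
  exact NonUnitalStarAlgebra.subset_adjoin ℂ _ hP

theorem adjoin_eq_of_subset {A : NonUnitalStarSubalgebra ℂ (H →ₗ[ℂ] H)} {s t : Set (H →ₗ[ℂ] H)}
    (hs : NonUnitalStarAlgebra.adjoin ℂ s = A) (ht : t ⊆ A)
    (hst : s ⊆ NonUnitalStarAlgebra.adjoin ℂ t) : NonUnitalStarAlgebra.adjoin ℂ t = A := by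
  apply le_antisymm (NonUnitalStarAlgebra.adjoin_le ht)
  rw [← hs]
  exact NonUnitalStarAlgebra.adjoin_le hst

/-- The invariant of the scattering loop. -/
structure NetworkInvariant (A : NonUnitalStarSubalgebra ℂ (H →ₗ[ℂ] H)) (N : Network H) :
    Prop where
  generates : Generates A N.projs
  unknown_mem : ∀ X Y, s(X, Y) ∈ N.unknown → X ∈ N.projs ∧ Y ∈ N.projs
  reflecting : ∀ X ∈ N.projs, ∀ Y ∈ N.projs, X ≠ Y → s(X, Y) ∉ N.unknown → Reflecting X Y

theorem mem_pairs {V : Finset (H →ₗ[ℂ] H)} {X Y : H →ₗ[ℂ] H} :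
    s(X, Y) ∈ pairs V ↔ X ∈ V ∧ Y ∈ V ∧ X ≠ Y := by
  simp only [pairs, Finset.mem_image, Finset.mem_offDiag, Prod.exists, Sym2.eq_iff]
  constructor
  · rintro ⟨a, b, ⟨ha, hb, hne⟩, ⟨rfl, rfl⟩ | ⟨rfl, rfl⟩⟩
    · exact ⟨ha, hb, hne⟩
    · exact ⟨hb, ha, hne.symm⟩
  · rintro ⟨hX, hY, hne⟩
    exact ⟨X, Y, ⟨hX, hY, hne⟩, Or.inl ⟨rfl, rfl⟩⟩

theorem generates_allSpectralProjections {𝓜 : Finset (H →ₗ[ℂ] H)}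
    (h𝓜 : ∀ M ∈ 𝓜, IsSelfAdjoint M) :
    Generates (NonUnitalStarAlgebra.adjoin ℂ (𝓜 : Set (H →ₗ[ℂ] H)))
      (allSpectralProjections 𝓜) where
  proj P hP := by
    obtain ⟨M, -, hP⟩ := Finset.mem_biUnion.1 hP
    exact isStarProjection_of_mem_spectralProjections hP
  ne_zero P hP := by
    obtain ⟨M, -, hP⟩ := Finset.mem_biUnion.1 hP
    exact ne_zero_of_mem_spectralProjections hP
  adjoin_eq := by
    apply adjoin_eq_of_subset rfl
    · intro P hP
      obtain ⟨M, hM, hP⟩ := Finset.mem_biUnion.1 hP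
      exact mem_of_mem_spectralProjections (h𝓜 M hM).isStarNormal
        (NonUnitalStarAlgebra.subset_adjoin ℂ _ hM) hP
    · intro M hM
      have : (spectralProjections M : Set (H →ₗ[ℂ] H)) ⊆ allSpectralProjections 𝓜 :=
        Finset.subset_biUnion_of_mem spectralProjections hM
      exact NonUnitalStarAlgebra.adjoin_mono this
        (mem_adjoin_spectralProjections (h𝓜 M hM).isStarNormal)

theorem IsInitialNetwork.networkInvariant {𝓜 : Finset (H →ₗ[ℂ] H)}
    (h𝓜 : ∀ M ∈ 𝓜, IsSelfAdjoint M) {N : Network H} (hN : IsInitialNetwork 𝓜 N) :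
    NetworkInvariant (NonUnitalStarAlgebra.adjoin ℂ (𝓜 : Set (H →ₗ[ℂ] H))) N where
  generates := by
    rw [hN.1]
    exact generates_allSpectralProjections h𝓜
  unknown_mem X Y h := by
    have := mem_pairs.1 (hN.2.1 h)
    exact ⟨this.1, this.2.1⟩
  reflecting := hN.2.2

/-! ### Replacement of a vertex by its parts -/

section Offspring

variable {P Q X : H →ₗ[ℂ] H}

theorem isStarProjection_of_mem_offspring (hP : IsStarProjection P) (hQ : IsStarProjection Q)
    (hX : IsStarProjection X) {R : H →ₗ[ℂ] H} (hR : R ∈ offspring P Q X) :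
    IsStarProjection R := by
  unfold offspring at hR
  split_ifs at hR
  · exact isStarProjection_of_mem_scatterParts hP hQ hR
  · exact isStarProjection_of_mem_scatterParts hQ hP hR
  · rwa [Finset.mem_singleton.1 hR]

theorem mul_of_mem_offspring (hP : IsStarProjection P) (hQ : IsStarProjection Q)
    (hX : IsStarProjection X) {R : H →ₗ[ℂ] H} (hR : R ∈ offspring P Q X) : X * R = R := by
  unfold offspring at hR
  split_ifs at hR with h1 h2
  · subst h1; exact mul_of_mem_scatterParts hP hR
  · subst h2; exact mul_of_mem_scatterParts hQ hR
  · rw [Finset.mem_singleton.1 hR, hX.isIdempotentElem.eq]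

theorem ne_zero_of_mem_offspring (hX : X ≠ 0) {R : H →ₗ[ℂ] H} (hR : R ∈ offspring P Q X) :
    R ≠ 0 := by
  unfold offspring at hR
  split_ifs at hR with h1 h2
  · exact (mem_scatterParts.1 hR).1
  · exact (mem_scatterParts.1 hR).1
  · rwa [Finset.mem_singleton.1 hR]

theorem sumAll_offspring (hP : IsStarProjection P) (hQ : IsStarProjection Q) :
    sumAll (offspring P Q X) = X := by
  unfold offspring
  split_ifs with h1 h2
  · rw [h1, sumAll_scatterParts hP hQ]
  · rw [h2, sumAll_scatterParts hQ hP]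
  · simp [sumAll]

theorem mem_of_mem_offspring {A : NonUnitalStarSubalgebra ℂ (H →ₗ[ℂ] H)}
    (hP : IsStarProjection P) (hQ : IsStarProjection Q) (hPA : P ∈ A) (hQA : Q ∈ A) (hXA : X ∈ A)
    {R : H →ₗ[ℂ] H} (hR : R ∈ offspring P Q X) : R ∈ A := by
  unfold offspring at hR
  split_ifs at hR
  · exact mem_of_mem_scatterParts hP hQ hPA hQA hR
  · exact mem_of_mem_scatterParts hQ hP hQA hPA hR
  · rwa [Finset.mem_singleton.1 hR]

end Offspring

theorem Network.mem_projsAfter {N : Network H} {P Q R : H →ₗ[ℂ] H} :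
    R ∈ N.projsAfter P Q ↔ ∃ X ∈ N.projs, R ∈ offspring P Q X := by
  simp [Network.projsAfter]

theorem Generates.projsAfter {A : NonUnitalStarSubalgebra ℂ (H →ₗ[ℂ] H)} {N : Network H}
    (h : Generates A N.projs) {P Q : H →ₗ[ℂ] H} (hP : P ∈ N.projs) (hQ : Q ∈ N.projs) :
    Generates A (N.projsAfter P Q) where
  proj R hR := by
    obtain ⟨X, hX, hR⟩ := Network.mem_projsAfter.1 hR
    exact isStarProjection_of_mem_offspring (h.proj P hP) (h.proj Q hQ) (h.proj X hX) hR
  ne_zero R hR := by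
    obtain ⟨X, hX, hR⟩ := Network.mem_projsAfter.1 hR
    exact ne_zero_of_mem_offspring (h.ne_zero X hX) hR
  adjoin_eq := by
    apply adjoin_eq_of_subset h.adjoin_eq
    · intro R hR
      obtain ⟨X, hX, hR⟩ := Network.mem_projsAfter.1 hR
      exact mem_of_mem_offspring (h.proj P hP) (h.proj Q hQ) (h.mem hP) (h.mem hQ) (h.mem hX) hR
    · intro X hX
      rw [SetLike.mem_coe, ← sumAll_offspring (X := X) (h.proj P hP) (h.proj Q hQ)]
      exact sumAll_mem fun R hR => NonUnitalStarAlgebra.subset_adjoin ℂ _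
        (Network.mem_projsAfter.2 ⟨X, hX, hR⟩)

theorem KnownAfter.reflecting {A : NonUnitalStarSubalgebra ℂ (H →ₗ[ℂ] H)} {N : Network H}
    (h : NetworkInvariant A N) {P Q : H →ₗ[ℂ] H} (hP : P ∈ N.projs) (hQ : Q ∈ N.projs)
    {X Y : H →ₗ[ℂ] H} (hne : X ≠ Y) (hk : KnownAfter N P Q X Y) : Reflecting X Y := by
  have hP := h.generates.proj P hP
  have hQ := h.generates.proj Q hQ
  obtain ⟨hX, hY⟩ | ⟨hX, hY, hu⟩ | ⟨X₀, hX₀, Y₀, hY₀, hX, hY, h0, hu⟩ := hk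
  · obtain hX | hX := Finset.mem_union.1 hX <;> obtain hY | hY := Finset.mem_union.1 hY
    · exact reflecting_of_mul_eq_zero
        (isStarProjection_of_mem_scatterParts hP hQ hX).isSelfAdjoint
        (isStarProjection_of_mem_scatterParts hP hQ hY).isSelfAdjoint
        (pairwiseOrthogonal_scatterParts hP hQ hX hY hne)
    · exact reflecting_of_mem_scatterParts hP hQ hX hY
    · exact reflecting_of_mem_scatterParts hQ hP hX hY
    · exact reflecting_of_mul_eq_zero
        (isStarProjection_of_mem_scatterParts hQ hP hX).isSelfAdjoint
        (isStarProjection_of_mem_scatterParts hQ hP hY).isSelfAdjoint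
        (pairwiseOrthogonal_scatterParts hQ hP hX hY hne)
  · exact h.reflecting X hX Y hY hne hu
  · have hX₀ := h.generates.proj X₀ hX₀
    have hY₀ := h.generates.proj Y₀ hY₀
    have hXs := isStarProjection_of_mem_offspring hP hQ hX₀ hX
    have hYs := isStarProjection_of_mem_offspring hP hQ hY₀ hY
    apply reflecting_of_mul_eq_zero hXs.isSelfAdjoint hYs.isSelfAdjoint
    -- Orthogonality is inherited by subprojections: `X Y = X X₀ Y₀ Y`.
    rw [← mul_of_mem_offspring hP hQ hY₀ hY,
      ← mul_eq_right_symm hX₀.isSelfAdjoint hXs.isSelfAdjoint (mul_of_mem_offspring hP hQ hX₀ hX),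
      mul_assoc, ← mul_assoc X₀, h0, zero_mul, mul_zero]

theorem NetworkInvariant.scatter {A : NonUnitalStarSubalgebra ℂ (H →ₗ[ℂ] H)} {N : Network H}
    (h : NetworkInvariant A N) {P Q : H →ₗ[ℂ] H} (hP : P ∈ N.projs) (hQ : Q ∈ N.projs) :
    NetworkInvariant A (N.scatter P Q) where
  generates := h.generates.projsAfter hP hQ
  unknown_mem X Y hXY := by
    have := mem_pairs.1 (Finset.mem_filter.1 hXY).1
    exact ⟨this.1, this.2.1⟩
  reflecting X hX Y hY hne hu := by
    have : ∃ X' Y', s(X, Y) = s(X', Y') ∧ KnownAfter N P Q X' Y' := by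
      by_contra hc
      exact hu (Finset.mem_filter.2 ⟨mem_pairs.2 ⟨hX, hY, hne⟩, hc⟩)
    obtain ⟨X', Y', he, hk⟩ := this
    obtain ⟨rfl, rfl⟩ | ⟨rfl, rfl⟩ := Sym2.eq_iff.1 he
    · exact hk.reflecting h hP hQ hne
    · exact (hk.reflecting h hP hQ hne.symm).symm

/-! ### Path isometries -/

theorem reflectWith_reflCoeff {P Q : H →ₗ[ℂ] H} (h : Reflecting P Q) :
    ReflectWith P Q (reflCoeff P Q) := Classical.epsilon_spec h

/-- Comparing norms, `‖Q P x‖² = ⟪x, P Q P x⟫ = l ‖P x‖²`, and `x` can be chosen with `Q P x ≠ 0`.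
Positivity makes the square roots in path isometries invertible. -/
theorem ReflectWith.pos {P Q : H →ₗ[ℂ] H} {l : ℝ} (h : ReflectWith P Q l)
    (hP : IsStarProjection P) (hQ : IsStarProjection Q) (hPQ : P * Q ≠ 0) : 0 < l := by
  have hQP : Q * P ≠ 0 := fun h0 => hPQ (mul_eq_zero_symm hQ.isSelfAdjoint hP.isSelfAdjoint h0)
  obtain ⟨x, hx⟩ : ∃ x, (Q * P) x ≠ 0 := by
    by_contra hc
    push Not at hc
    exact hQP (LinearMap.ext hc)
  have h1 : star (Q * P) * (Q * P) = (l : ℂ) • (star P * P) := by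
    rw [star_mul, hP.isSelfAdjoint.star_eq, hQ.isSelfAdjoint.star_eq, hP.isIdempotentElem.eq, ← h.1,
      mul_assoc, ← mul_assoc Q, hQ.isIdempotentElem.eq, mul_assoc]
  have h2 : inner ℂ ((Q * P) x) ((Q * P) x) = (l : ℂ) * inner ℂ (P x) (P x) := by
    rw [← LinearMap.adjoint_inner_right, ← LinearMap.star_eq_adjoint, ← Module.End.mul_apply, h1,
      LinearMap.smul_apply, inner_smul_right, Module.End.mul_apply, LinearMap.star_eq_adjoint,
      LinearMap.adjoint_inner_right]
  rw [inner_self_eq_norm_sq_to_K, inner_self_eq_norm_sq_to_K] at h2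
  have h3 : ‖(Q * P) x‖ ^ 2 = l * ‖P x‖ ^ 2 := by
    apply Complex.ofReal_injective
    push_cast
    exact h2
  have h4 : 0 < l * ‖P x‖ ^ 2 := by rw [← h3]; positivity
  exact pos_of_mul_pos_left h4 (by positivity)

/-- The vertices of `V` are pairwise reflecting nonzero projections that generate `A`. -/
structure ProperNetwork (A : NonUnitalStarSubalgebra ℂ (H →ₗ[ℂ] H)) (V : Finset (H →ₗ[ℂ] H)) :
    Prop extends Generates A V where
  reflecting : ∀ X ∈ V, ∀ Y ∈ V, X ≠ Y → Reflecting X Y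

theorem graph_adj {V : Finset (H →ₗ[ℂ] H)} {P Q : V} : (graph V).Adj P Q ↔
    P ≠ Q ∧ ((P : H →ₗ[ℂ] H) * (Q : H →ₗ[ℂ] H) ≠ 0 ∨ (Q : H →ₗ[ℂ] H) * (P : H →ₗ[ℂ] H) ≠ 0) :=
  Iff.rfl

section Path

variable {A : NonUnitalStarSubalgebra ℂ (H →ₗ[ℂ] H)} {V : Finset (H →ₗ[ℂ] H)}

theorem ProperNetwork.adj_iff (h : ProperNetwork A V) {P Q : V} : (graph V).Adj P Q ↔
    P ≠ Q ∧ (P : H →ₗ[ℂ] H) * (Q : H →ₗ[ℂ] H) ≠ 0 := by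
  rw [graph_adj]
  refine and_congr_right fun _ => or_iff_left_of_imp fun hQP hPQ => hQP ?_
  exact mul_eq_zero_symm (h.proj P P.2).isSelfAdjoint (h.proj Q Q.2).isSelfAdjoint hPQ

/-- The product of the projections along a walk. -/
def walkProd {P Q : V} (w : (graph V).Walk P Q) : H →ₗ[ℂ] H :=
  (w.support.map Subtype.val).prod

/-- The product of the reflection coefficients along a walk. -/
def walkCoeff {P Q : V} (w : (graph V).Walk P Q) : ℝ :=
  coeffProd (w.support.map Subtype.val)

theorem pathIsometry_eq {P Q : V} (w : (graph V).Walk P Q) :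
    pathIsometry w = (((√(walkCoeff w))⁻¹ : ℝ) : ℂ) • walkProd w := rfl

@[simp] theorem walkProd_nil (P : V) :
    walkProd (SimpleGraph.Walk.nil : (graph V).Walk P P) = P := by simp [walkProd]

@[simp] theorem walkCoeff_nil (P : V) :
    walkCoeff (SimpleGraph.Walk.nil : (graph V).Walk P P) = 1 := by simp [walkCoeff, coeffProd]

@[simp] theorem walkProd_cons {P Q R : V} (h : (graph V).Adj P Q) (w : (graph V).Walk Q R) :
    walkProd (SimpleGraph.Walk.cons h w) = P * walkProd w := by simp [walkProd]

@[simp] theorem walkCoeff_cons {P Q R : V} (h : (graph V).Adj P Q) (w : (graph V).Walk Q R) :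
    walkCoeff (SimpleGraph.Walk.cons h w) = reflCoeff (P : H →ₗ[ℂ] H) Q * walkCoeff w := by
  rw [walkCoeff, walkCoeff, SimpleGraph.Walk.support_cons, ← w.cons_tail_support,
    List.map_cons, List.map_cons, coeffProd]

theorem pathIsometry_nil (P : V) :
    pathIsometry (SimpleGraph.Walk.nil : (graph V).Walk P P) = P := by simp [pathIsometry_eq]

theorem mem_component {C : (graph V).ConnectedComponent} {R : H →ₗ[ℂ] H} :
    R ∈ component V C ↔ ∃ hR : R ∈ V, (graph V).connectedComponentMk ⟨R, hR⟩ = C := by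
  simp [component]

namespace ProperNetwork

variable (h : ProperNetwork A V)
include h

theorem mul_walkProd {P Q : V} (w : (graph V).Walk P Q) :
    (P : H →ₗ[ℂ] H) * walkProd w = walkProd w := by
  cases w with
  | nil => rw [walkProd_nil, (h.proj P P.2).isIdempotentElem.eq]
  | cons a w => rw [walkProd_cons, ← mul_assoc, (h.proj P P.2).isIdempotentElem.eq]

theorem walkProd_mul {P Q : V} (w : (graph V).Walk P Q) :
    walkProd w * (Q : H →ₗ[ℂ] H) = walkProd w := by
  induction w with
  | @nil P => rw [walkProd_nil, (h.proj P P.2).isIdempotentElem.eq]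
  | cons a w ih => rw [walkProd_cons, mul_assoc, ih]

theorem walkProd_mem {P Q : V} (w : (graph V).Walk P Q) : walkProd w ∈ A := by
  induction w with
  | @nil P => rw [walkProd_nil]; exact h.mem P.2
  | @cons P Q R a w ih => rw [walkProd_cons]; exact mul_mem (h.mem P.2) ih

theorem reflectWith_of_adj {P Q : V} (a : (graph V).Adj P Q) :
    ReflectWith (P : H →ₗ[ℂ] H) Q (reflCoeff (P : H →ₗ[ℂ] H) Q) :=
  reflectWith_reflCoeff (h.reflecting P P.2 Q Q.2 fun e => a.ne (Subtype.ext e))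

theorem reflCoeff_pos {P Q : V} (a : (graph V).Adj P Q) : 0 < reflCoeff (P : H →ₗ[ℂ] H) Q :=
  (h.reflectWith_of_adj a).pos (h.proj P P.2) (h.proj Q Q.2) (h.adj_iff.1 a).2

theorem walkCoeff_pos {P Q : V} (w : (graph V).Walk P Q) : 0 < walkCoeff w := by
  induction w with
  | @nil P => simp
  | cons a w ih => rw [walkCoeff_cons]; exact mul_pos (h.reflCoeff_pos a) ih

/-- The product collapses from the inside: the tail of the walk leaves a multiple of its first
vertex `Q`, and then `P Q P` yields the next coefficient. -/
theorem walkProd_mul_star {P Q : V} (w : (graph V).Walk P Q) :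
    walkProd w * star (walkProd w) = (walkCoeff w : ℂ) • (P : H →ₗ[ℂ] H) := by
  induction w with
  | @nil P =>
    rw [walkProd_nil, (h.proj P P.2).isSelfAdjoint.star_eq, (h.proj P P.2).isIdempotentElem.eq]
    simp
  | @cons P Q R a w ih =>
    rw [walkProd_cons, star_mul, mul_assoc, ← mul_assoc (walkProd w), ih,
      (h.proj P P.2).isSelfAdjoint.star_eq, smul_mul_assoc, mul_smul_comm, ← mul_assoc,
      (h.reflectWith_of_adj a).1, walkCoeff_cons, smul_smul, mul_comm]
    push_cast
    rfl

theorem star_walkProd_mul {P Q : V} (w : (graph V).Walk P Q) :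
    star (walkProd w) * walkProd w = (walkCoeff w : ℂ) • (Q : H →ₗ[ℂ] H) := by
  induction w with
  | @nil P =>
    rw [walkProd_nil, (h.proj P P.2).isSelfAdjoint.star_eq, (h.proj P P.2).isIdempotentElem.eq]
    simp
  | @cons P Q R a w ih =>
    have h1 : star (walkProd w) * (Q : H →ₗ[ℂ] H) = star (walkProd w) := by
      simpa [(h.proj Q Q.2).isSelfAdjoint.star_eq] using congrArg star (h.mul_walkProd w)
    -- Here the first edge sits in the middle; absorbing `Q` on both sides of `P` exposes `Q P Q`.
    have h2 : star (walkProd w) * (P : H →ₗ[ℂ] H) * walkProd w =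
        star (walkProd w) * ((Q : H →ₗ[ℂ] H) * P * Q) * walkProd w := by
      calc star (walkProd w) * (P : H →ₗ[ℂ] H) * walkProd w =
          star (walkProd w) * (Q : H →ₗ[ℂ] H) * P * (Q * walkProd w) := by
            rw [h1, h.mul_walkProd]
        _ = _ := by simp only [mul_assoc]
    rw [walkProd_cons, star_mul, mul_assoc, ← mul_assoc (star (P : H →ₗ[ℂ] H)),
      (h.proj P P.2).isSelfAdjoint.star_eq, (h.proj P P.2).isIdempotentElem.eq, ← mul_assoc, h2,
      (h.reflectWith_of_adj a).2, mul_smul_comm, h1, smul_mul_assoc, ih, smul_smul, walkCoeff_cons]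
    push_cast
    rfl

theorem inv_sqrt_mul_inv_sqrt {P Q : V} (w : (graph V).Walk P Q) :
    (((√(walkCoeff w))⁻¹ : ℝ) : ℂ) * (((√(walkCoeff w))⁻¹ : ℝ) : ℂ) * (walkCoeff w : ℂ) = 1 := by
  have hw := h.walkCoeff_pos w
  have : (√(walkCoeff w))⁻¹ * (√(walkCoeff w))⁻¹ * walkCoeff w = 1 := by
    rw [← mul_inv, Real.mul_self_sqrt hw.le, inv_mul_cancel₀ hw.ne']
  exact_mod_cast this

theorem pathIsometry_mul_star {P Q : V} (w : (graph V).Walk P Q) :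
    pathIsometry w * star (pathIsometry w) = P := by
  rw [pathIsometry_eq, star_smul, smul_mul_smul_comm, h.walkProd_mul_star, smul_smul]
  simp only [RCLike.star_def, Complex.conj_ofReal]
  rw [h.inv_sqrt_mul_inv_sqrt, one_smul]

theorem star_pathIsometry_mul {P Q : V} (w : (graph V).Walk P Q) :
    star (pathIsometry w) * pathIsometry w = Q := by
  rw [pathIsometry_eq, star_smul, smul_mul_smul_comm, h.star_walkProd_mul, smul_smul]
  simp only [RCLike.star_def, Complex.conj_ofReal]
  rw [h.inv_sqrt_mul_inv_sqrt, one_smul]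

theorem mul_pathIsometry {P Q : V} (w : (graph V).Walk P Q) :
    (P : H →ₗ[ℂ] H) * pathIsometry w = pathIsometry w := by
  rw [pathIsometry_eq, mul_smul_comm, h.mul_walkProd]

theorem pathIsometry_mul {P Q : V} (w : (graph V).Walk P Q) :
    pathIsometry w * (Q : H →ₗ[ℂ] H) = pathIsometry w := by
  rw [pathIsometry_eq, smul_mul_assoc, h.walkProd_mul]

theorem star_pathIsometry_mul_left {P Q : V} (w : (graph V).Walk P Q) :
    star (pathIsometry w) * (P : H →ₗ[ℂ] H) = star (pathIsometry w) := by
  simpa [(h.proj P P.2).isSelfAdjoint.star_eq] using congrArg star (h.mul_pathIsometry w)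

theorem mul_star_pathIsometry {P Q : V} (w : (graph V).Walk P Q) :
    (Q : H →ₗ[ℂ] H) * star (pathIsometry w) = star (pathIsometry w) := by
  simpa [(h.proj Q Q.2).isSelfAdjoint.star_eq] using congrArg star (h.pathIsometry_mul w)

theorem pathIsometry_mem {P Q : V} (w : (graph V).Walk P Q) : pathIsometry w ∈ A := by
  rw [pathIsometry_eq]
  exact SMulMemClass.smul_mem _ (h.walkProd_mem w)

theorem walkProd_eq_smul {P Q : V} (w : (graph V).Walk P Q) :
    walkProd w = ((√(walkCoeff w) : ℝ) : ℂ) • pathIsometry w := by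
  have : √(walkCoeff w) ≠ 0 := (Real.sqrt_pos.2 (h.walkCoeff_pos w)).ne'
  rw [pathIsometry_eq, smul_smul, ← Complex.ofReal_mul, mul_inv_cancel₀ this, Complex.ofReal_one,
    one_smul]

theorem exists_mul_pathIsometry {P Q R : V} (a : (graph V).Adj P Q) (w : (graph V).Walk Q R) :
    ∃ c : ℂ, (P : H →ₗ[ℂ] H) * pathIsometry w = c • pathIsometry (SimpleGraph.Walk.cons a w) := by
  refine ⟨(((√(walkCoeff w))⁻¹ : ℝ) : ℂ) * ((√(walkCoeff (SimpleGraph.Walk.cons a w)) : ℝ) : ℂ), ?_⟩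
  rw [pathIsometry_eq w, mul_smul_comm, ← walkProd_cons a w, h.walkProd_eq_smul, smul_smul]

/-! ### The spectral projections of loops -/

section Loop

variable {P Q : V} (w w' : (graph V).Walk P Q)

theorem loop_mul_star : pathIsometry w * star (pathIsometry w') *
    star (pathIsometry w * star (pathIsometry w')) = P := by
  rw [star_mul, star_star, mul_assoc, ← mul_assoc (star (pathIsometry w')),
    h.star_pathIsometry_mul w', h.mul_star_pathIsometry, h.pathIsometry_mul_star]

/-- The loop operator is unitary on the range of `P`: its adjoint is the loop with the two walks
exchanged, so both products with the adjoint equal `P`. -/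
theorem isStarNormal_loop : IsStarNormal (pathIsometry w * star (pathIsometry w')) := by
  constructor
  have h1 := h.loop_mul_star w w'
  have h2 := h.loop_mul_star w' w
  rw [star_mul, star_star] at h1 h2 ⊢
  exact h2.trans h1.symm

theorem mul_loop : (P : H →ₗ[ℂ] H) * (pathIsometry w * star (pathIsometry w')) =
    pathIsometry w * star (pathIsometry w') := by
  rw [← mul_assoc, h.mul_pathIsometry]

theorem isStarProjection_of_mem_loopProjections {R : H →ₗ[ℂ] H}
    (hR : R ∈ loopProjections w w') : IsStarProjection R :=
  isStarProjection_of_mem_spectralProjections hR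

theorem mul_of_mem_loopProjections {R : H →ₗ[ℂ] H} (hR : R ∈ loopProjections w w') :
    (P : H →ₗ[ℂ] H) * R = R := mul_eq_of_mem_spectralProjections (h.mul_loop w w') hR

/-- If an eigenprojection were all of `P`, the loop operator would be `μ P`, and multiplying by the
second path isometry would make the two proportional. So the loop projections really break `P`. -/
theorem ne_of_mem_loopProjections (hw : ¬ Proportional w w') {R : H →ₗ[ℂ] H}
    (hR : R ∈ loopProjections w w') : R ≠ P := by
  rintro rfl
  obtain ⟨μ, -, hμ, he⟩ := mem_spectralProjections.1 hR
  refine hw ⟨μ, ?_⟩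
  have h1 := mul_eigenProj (pathIsometry w * star (pathIsometry w')) μ
  rw [he, mul_assoc, h.star_pathIsometry_mul_left] at h1
  rw [← h.mul_pathIsometry w', ← smul_mul_assoc, ← h1, mul_assoc, h.star_pathIsometry_mul,
    h.pathIsometry_mul]

/-- Without nonzero eigenvalues the normal loop operator would vanish, but its product with its
adjoint is `P ≠ 0`. -/
theorem loopProjections_nonempty : (loopProjections w w').Nonempty := by
  by_contra hne
  rw [Finset.not_nonempty_iff_eq_empty] at hne
  obtain ⟨c, hc⟩ := exists_eq_sum_spectralProjections (h.isStarNormal_loop w w')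
  rw [loopProjections] at hne
  rw [hne, Finset.sum_empty] at hc
  have := h.loop_mul_star w w'
  rw [hc, zero_mul] at this
  exact h.ne_zero P P.2 this.symm

theorem generates_addLoopProjections : Generates A (addLoopProjections w w').projs where
  proj R hR := by
    obtain hR | hR := Finset.mem_union.1 hR
    · exact h.proj R hR
    · exact isStarProjection_of_mem_spectralProjections hR
  ne_zero R hR := by
    obtain hR | hR := Finset.mem_union.1 hR
    · exact h.ne_zero R hR
    · exact ne_zero_of_mem_spectralProjections hR
  adjoin_eq := by
    apply adjoin_eq_of_subset h.adjoin_eq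
    · intro R hR
      obtain hR | hR := Finset.mem_union.1 hR
      · exact h.mem hR
      · exact mem_of_mem_spectralProjections (h.isStarNormal_loop w w')
          (mul_mem (h.pathIsometry_mem w) (star_mem (h.pathIsometry_mem w'))) hR
    · intro R hR
      exact NonUnitalStarAlgebra.subset_adjoin ℂ _ (Finset.mem_union_left _ hR)

theorem mul_eq_zero_of_not_mem_component {X R : H →ₗ[ℂ] H} (hX : X ∈ V)
    {C : (graph V).ConnectedComponent}
    (hR : R ∈ component V C) (hXC : X ∉ component V C) : X * R = 0 := by
  obtain ⟨hRV, rfl⟩ := mem_component.1 hR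
  by_contra h0
  apply hXC
  refine mem_component.2 ⟨hX, ?_⟩
  by_cases he : X = R
  · subst he; rfl
  · apply SimpleGraph.ConnectedComponent.sound
    exact (h.adj_iff.2 ⟨fun e => he (congrArg Subtype.val e), h0⟩ :
      (graph V).Adj ⟨X, hX⟩ ⟨R, hRV⟩).reachable

theorem networkInvariant_addLoopProjections :
    NetworkInvariant A (addLoopProjections w w') := by
  have hPC : (P : H →ₗ[ℂ] H) ∈ component V ((graph V).connectedComponentMk P) :=
    mem_component.2 ⟨P.2, rfl⟩
  have key : ∀ X ∈ V, ∀ Y ∈ loopProjections w w', s(X, Y) ∉ (addLoopProjections w w').unknown →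
      Reflecting X Y := by
    intro X hX Y hY hu
    -- A pair left unmarked involves a vertex outside the component of `P`. Such a vertex is
    -- orthogonal to `P`, hence to the loop projections below `P`.
    have hXC : X ∉ component V ((graph V).connectedComponentMk P) := by
      intro hXC
      exact hu (Finset.mem_image.2 ⟨(X, Y), Finset.mem_product.2 ⟨hXC, hY⟩, rfl⟩)
    apply reflecting_of_mul_eq_zero (h.proj X hX).isSelfAdjoint
      (isStarProjection_of_mem_spectralProjections hY).isSelfAdjoint
    rw [← h.mul_of_mem_loopProjections w w' hY, ← mul_assoc,
      h.mul_eq_zero_of_not_mem_component hX hPC hXC, zero_mul]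
  refine ⟨h.generates_addLoopProjections w w', ?_, ?_⟩
  · intro X Y hXY
    obtain ⟨⟨X', Y'⟩, hm, he⟩ := Finset.mem_image.1 hXY
    obtain ⟨hX', hY'⟩ := Finset.mem_product.1 hm
    have hX'' : X' ∈ (addLoopProjections w w').projs :=
      Finset.mem_union_left _ (mem_component.1 hX').1
    have hY'' : Y' ∈ (addLoopProjections w w').projs := Finset.mem_union_right _ hY'
    obtain ⟨rfl, rfl⟩ | ⟨rfl, rfl⟩ := Sym2.eq_iff.1 he
    · exact ⟨hX'', hY''⟩
    · exact ⟨hY'', hX''⟩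
  · intro X hX Y hY hne hu
    obtain hX | hX := Finset.mem_union.1 hX <;> obtain hY | hY := Finset.mem_union.1 hY
    · exact h.reflecting X hX Y hY hne
    · exact key X hX Y hY hu
    · exact (key Y hY X hX (by rwa [Sym2.eq_swap])).symm
    · exact reflecting_of_mul_eq_zero
        (isStarProjection_of_mem_spectralProjections hX).isSelfAdjoint
        (isStarProjection_of_mem_spectralProjections hY).isSelfAdjoint
        (mul_eq_zero_of_mem_spectralProjections (h.isStarNormal_loop w w') hX hY hne)

end Loop

end ProperNetwork

end Path

/-! ### Termination -/

section Termination

/-! ### Projections ordered by their ranges -/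

/-- The ranges of the projections in `V`. -/
def ranges (V : Finset (H →ₗ[ℂ] H)) : Finset (Submodule ℂ H) := V.image LinearMap.range

theorem range_le_range {P Q : H →ₗ[ℂ] H} (h : Q * P = P) :
    LinearMap.range P ≤ LinearMap.range Q := by
  rintro _ ⟨x, rfl⟩
  exact ⟨P x, LinearMap.congr_fun h x⟩

theorem mul_eq_of_range_le {P Q : H →ₗ[ℂ] H} (hQ : IsStarProjection Q)
    (h : LinearMap.range P ≤ LinearMap.range Q) : Q * P = P := by
  ext x
  obtain ⟨y, hy⟩ := h ⟨x, rfl⟩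
  rw [Module.End.mul_apply, ← hy, ← Module.End.mul_apply, hQ.isIdempotentElem.eq]

theorem eq_of_range_eq {P Q : H →ₗ[ℂ] H} (hP : IsStarProjection P) (hQ : IsStarProjection Q)
    (h : LinearMap.range P = LinearMap.range Q) : P = Q :=
  LinearMap.IsStarProjection.ext hP hQ h

theorem eigenProj_one {P : H →ₗ[ℂ] H} (hP : IsStarProjection P) : eigenProj P 1 = P := by
  have h1 : eigenProj P 1 * P = P := by
    ext x
    apply eigenProj_apply_of_mem
    rw [Module.End.mem_eigenspace_iff, one_smul, ← Module.End.mul_apply, hP.isIdempotentElem.eq]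
  rwa [eigenProj_mul hP.isSelfAdjoint.isStarNormal, one_smul] at h1

/-- A projection below its partner passes unbroken: then `P Q P = P`, whose eigenprojection for `1`
is `P`. -/
theorem mem_scatterParts_self {P Q : H →ₗ[ℂ] H} (hP : IsStarProjection P) (h0 : P ≠ 0)
    (h : Q * P = P) : P ∈ scatterParts P Q := by
  have h1 := eigenProj_one hP
  refine mem_scatterParts.2 ⟨h0, Or.inr (mem_spectralProjections.2 ⟨1, ?_, one_ne_zero, ?_⟩)⟩
  · rw [mul_assoc, h, hP.isIdempotentElem.eq, ← eigenProj_ne_zero_iff, h1]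
    exact h0
  · rw [mul_assoc, h, hP.isIdempotentElem.eq, h1]

theorem eq_of_mem_scatterParts_self {P Q R : H →ₗ[ℂ] H} (hP : IsStarProjection P)
    (hQ : IsStarProjection Q) (h : P ∈ scatterParts P Q) (hR : R ∈ scatterParts P Q) : R = P := by
  by_contra hne
  have : P * R = 0 := pairwiseOrthogonal_scatterParts hP hQ h hR (Ne.symm hne)
  rw [mul_of_mem_scatterParts hP hR] at this
  exact (mem_scatterParts.1 hR).1 this

/-- A vertex might reappear only as a part of its scattering partner. In that case it lies below the
partner, so it is also an unbroken part of itself. -/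
theorem mem_offspring_of_mem_projsAfter {V : Finset (H →ₗ[ℂ] H)} {P Q X Z : H →ₗ[ℂ] H}
    (hV : ∀ P ∈ V, IsStarProjection P) (h0 : ∀ P ∈ V, P ≠ 0) (hP : P ∈ V) (hQ : Q ∈ V)
    (hX : X ∈ V) (hXZ : X ∈ offspring P Q Z) : X ∈ offspring P Q X := by
  by_cases h1 : Z = P
  · subst h1
    by_cases h2 : X = Z
    · subst h2; exact hXZ
    by_cases h3 : X = Q
    · subst h3
      rw [offspring, if_pos rfl] at hXZ
      rw [offspring, if_neg h2, if_pos rfl]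
      exact mem_scatterParts_self (hV _ hX) (h0 _ hX) (mul_of_mem_scatterParts (hV _ hP) hXZ)
    · simp [offspring, h2, h3]
  by_cases h2 : Z = Q
  · subst h2
    by_cases h3 : X = P
    · subst h3
      rw [offspring, if_neg h1, if_pos rfl] at hXZ
      rw [offspring, if_pos rfl]
      exact mem_scatterParts_self (hV _ hX) (h0 _ hX) (mul_of_mem_scatterParts (hV _ hQ) hXZ)
    by_cases h4 : X = Z
    · subst h4; exact hXZ
    · simp [offspring, h3, h4]
  · have : X = Z := by simpa [offspring, h1, h2] using hXZ
    subst this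
    exact hXZ

theorem eq_of_mem_offspring_self {P Q X R : H →ₗ[ℂ] H} (hP : IsStarProjection P)
    (hQ : IsStarProjection Q) (hX : X ∈ offspring P Q X) (hR : R ∈ offspring P Q X) : R = X := by
  unfold offspring at hX hR
  split_ifs at hX hR with h1 h2
  · subst h1; exact eq_of_mem_scatterParts_self hP hQ hX hR
  · subst h2; exact eq_of_mem_scatterParts_self hQ hP hX hR
  · simpa using hR

theorem offspring_nonempty {P Q X : H →ₗ[ℂ] H} (hP : IsStarProjection P)
    (hQ : IsStarProjection Q) (hX : X ≠ 0) : (offspring P Q X).Nonempty := by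
  by_contra hne
  have := sumAll_offspring (X := X) hP hQ
  rw [Finset.not_nonempty_iff_eq_empty.1 hne, sumAll, Finset.sum_empty] at this
  exact hX this.symm

variable {A : NonUnitalStarSubalgebra ℂ (H →ₗ[ℂ] H)}

/-- The point is that a properly broken vertex disappears: if it is still present, it is among its
own parts, and being orthogonal to the others it is the only one. -/
theorem NetworkInvariant.refines {N : Network H} (h : NetworkInvariant A N) {P Q : H →ₗ[ℂ] H}
    (hP : P ∈ N.projs) (hQ : Q ∈ N.projs) :
    Refines (ranges (N.projsAfter P Q)) (ranges N.projs) where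
  exists_ge x hx := by
    obtain ⟨R, hR, rfl⟩ := Finset.mem_image.1 hx
    obtain ⟨X, hX, hRX⟩ := Network.mem_projsAfter.1 hR
    have hV := h.generates.proj
    refine ⟨_, Finset.mem_image_of_mem _ hX,
      range_le_range (mul_of_mem_offspring (hV P hP) (hV Q hQ) (hV X hX) hRX), ?_⟩
    by_contra hc
    push Not at hc
    obtain ⟨X', hX', he⟩ := Finset.mem_image.1 hc.2
    have := eq_of_range_eq ((h.generates.projsAfter hP hQ).proj X' hX') (hV X hX) he
    subst this
    obtain ⟨Z, hZ, hXZ⟩ := Network.mem_projsAfter.1 hX'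
    have hXX := mem_offspring_of_mem_projsAfter hV h.generates.ne_zero hP hQ hX hXZ
    exact hc.1 (by rw [eq_of_mem_offspring_self (hV P hP) (hV Q hQ) hXX hRX])
  exists_le y hy := by
    obtain ⟨X, hX, rfl⟩ := Finset.mem_image.1 hy
    have hV := h.generates.proj
    obtain ⟨R, hR⟩ := offspring_nonempty (hV P hP) (hV Q hQ) (h.generates.ne_zero X hX)
    exact ⟨_, Finset.mem_image_of_mem _ (Network.mem_projsAfter.2 ⟨X, hX, hR⟩),
      range_le_range (mul_of_mem_offspring (hV P hP) (hV Q hQ) (hV X hX) hR)⟩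

theorem eq_of_ranges_eq {V V' : Finset (H →ₗ[ℂ] H)} (hV : ∀ P ∈ V, IsStarProjection P)
    (hV' : ∀ P ∈ V', IsStarProjection P) (h : ranges V = ranges V') : V = V' := by
  have key : ∀ V V' : Finset (H →ₗ[ℂ] H), (∀ P ∈ V, IsStarProjection P) →
      (∀ P ∈ V', IsStarProjection P) → ranges V = ranges V' → V ⊆ V' := by
    intro V V' hV hV' h P hP
    have hm : LinearMap.range P ∈ ranges V' := by
      rw [← h]; exact Finset.mem_image_of_mem _ hP
    obtain ⟨Q, hQ, he⟩ := Finset.mem_image.1 hm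
    rwa [← eq_of_range_eq (hV' Q hQ) (hV P hP) he]
  exact Finset.Subset.antisymm (key V V' hV hV' h) (key V' V hV' hV h.symm)

theorem Network.mem_scatterParts_of_projsAfter_eq {N : Network H} {P Q : H →ₗ[ℂ] H}
    (he : N.projsAfter P Q = N.projs) {X : H →ₗ[ℂ] H} (hX : X ∈ N.projs) (h : X = P ∨ X = Q) :
    X ∈ scatterParts P Q ∪ scatterParts Q P := by
  rw [← he] at hX
  obtain ⟨Z, -, hXZ⟩ := Network.mem_projsAfter.1 hX
  unfold offspring at hXZ
  split_ifs at hXZ with h1 h2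
  · exact Finset.mem_union_left _ hXZ
  · exact Finset.mem_union_right _ hXZ
  · have := Finset.mem_singleton.1 hXZ
    subst this
    exact absurd h (by tauto)

/-- When no vertex breaks, `P` and `Q` are themselves products of the scattering, so their pair
becomes known, while every pair known before stays known. -/
theorem Network.card_unknown_scatter_lt {N : Network H} {P Q : H →ₗ[ℂ] H} (hP : P ∈ N.projs)
    (hQ : Q ∈ N.projs) (h : s(P, Q) ∈ N.unknown) (he : N.projsAfter P Q = N.projs) :
    (N.scatter P Q).unknown.card < N.unknown.card := by
  apply Finset.card_lt_card
  rw [Finset.ssubset_iff_of_subset]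
  · refine ⟨_, h, fun hc => (Finset.mem_filter.1 hc).2 ⟨P, Q, rfl, Or.inl ?_⟩⟩
    exact ⟨mem_scatterParts_of_projsAfter_eq he hP (Or.inl rfl),
      mem_scatterParts_of_projsAfter_eq he hQ (Or.inr rfl)⟩
  · intro z
    refine Sym2.ind (fun X Y => ?_) z
    intro hz
    obtain ⟨hz1, hz2⟩ := Finset.mem_filter.1 hz
    obtain ⟨hX, hY, -⟩ := mem_pairs.1 hz1
    rw [he] at hX hY
    by_contra hu
    exact hz2 ⟨X, Y, rfl, Or.inr (Or.inl ⟨hX, hY, hu⟩)⟩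

/-- Reflecting projections are never properly nested: if `P ≤ Q`, then `P = Q P Q = l Q` with `l ≠
0`, so the ranges agree. -/
theorem ProperNetwork.maxElements_ranges {V : Finset (H →ₗ[ℂ] H)} (h : ProperNetwork A V) :
    maxElements (ranges V) = ranges V := by
  refine Finset.Subset.antisymm (Finset.filter_subset _ _) fun x hx => ?_
  refine mem_maxElements.2 ⟨hx, fun y hy hxy => ?_⟩
  obtain ⟨P, hP, rfl⟩ := Finset.mem_image.1 hx
  obtain ⟨Q, hQ, rfl⟩ := Finset.mem_image.1 hy
  by_cases hne : P = Q
  · rw [hne]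
  obtain ⟨l, h1, h2⟩ := h.reflecting P hP Q hQ hne
  have hQP := mul_eq_of_range_le (h.proj Q hQ) hxy
  have hPQ := mul_eq_right_symm (h.proj Q hQ).isSelfAdjoint (h.proj P hP).isSelfAdjoint hQP
  rw [hQP, hPQ] at h2
  have hl : (l : ℂ) ≠ 0 := by
    intro h0
    rw [h0, zero_smul] at h2
    exact h.ne_zero P hP h2
  apply le_antisymm hxy
  rintro _ ⟨v, rfl⟩
  refine ⟨(l : ℂ)⁻¹ • v, ?_⟩
  rw [h2, LinearMap.smul_apply, map_smul, smul_smul, mul_inv_cancel₀ hl, one_smul]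

theorem ranges_union (V V' : Finset (H →ₗ[ℂ] H)) : ranges (V ∪ V') = ranges V ∪ ranges V' :=
  Finset.image_union _ _

section Loop

variable {V : Finset (H →ₗ[ℂ] H)} {P Q : V} (w w' : (graph V).Walk P Q)

theorem ProperNetwork.range_lt_of_mem_loopProjections (h : ProperNetwork A V)
    (hw : ¬ Proportional w w') {R : H →ₗ[ℂ] H} (hR : R ∈ loopProjections w w') :
    LinearMap.range R < LinearMap.range (P : H →ₗ[ℂ] H) := by
  refine lt_of_le_of_ne (range_le_range (h.mul_of_mem_loopProjections w w' hR)) fun he => ?_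
  exact h.ne_of_mem_loopProjections w w' hw hR
    (eq_of_range_eq (h.isStarProjection_of_mem_loopProjections w w' hR) (h.proj P P.2) he)

theorem ProperNetwork.maxElements_addLoopProjections (h : ProperNetwork A V)
    (hw : ¬ Proportional w w') :
    maxElements (ranges (addLoopProjections w w').projs) = ranges V := by
  rw [addLoopProjections, ranges_union]
  refine maxElements_union h.maxElements_ranges fun x hx => ?_
  obtain ⟨R, hR, rfl⟩ := Finset.mem_image.1 hx
  exact ⟨_, Finset.mem_image_of_mem _ P.2, h.range_lt_of_mem_loopProjections w w' hw hR⟩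

theorem ProperNetwork.antichainFlag_addLoopProjections (h : ProperNetwork A V)
    (hw : ¬ Proportional w w') : antichainFlag (ranges (addLoopProjections w w').projs) = 0 := by
  rw [antichainFlag, if_neg]
  rw [h.maxElements_addLoopProjections w w' hw]
  intro he
  obtain ⟨R, hR⟩ := h.loopProjections_nonempty w w'
  have hlt := h.range_lt_of_mem_loopProjections w w' hw hR
  have hmem : LinearMap.range R ∈ ranges V := by
    rw [he]
    exact Finset.mem_image_of_mem _ (Finset.mem_union_right _ hR)
  rw [← h.maxElements_ranges] at hmem
  exact hlt.ne ((mem_maxElements.1 hmem).2 _ (Finset.mem_image_of_mem _ P.2) hlt.le)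

end Loop

/-! ### The termination measure -/

/-- The well-founded order that the runs of the algorithm descend. -/
def measureRel : ℕ × Multiset ℕ × ℕ × Multiset ℕ × ℕ → ℕ × Multiset ℕ × ℕ × Multiset ℕ × ℕ → Prop :=
  Prod.Lex (· < ·) (Prod.Lex Multiset.IsDershowitzMannaLT
    (Prod.Lex (· < ·) (Prod.Lex Multiset.IsDershowitzMannaLT (· < ·))))

theorem wellFounded_measureRel : WellFounded measureRel :=
  WellFounded.prod_lex Nat.lt_wfRel.wf <|
    WellFounded.prod_lex Multiset.wellFounded_isDershowitzMannaLT <|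
    WellFounded.prod_lex Nat.lt_wfRel.wf <|
    WellFounded.prod_lex Multiset.wellFounded_isDershowitzMannaLT Nat.lt_wfRel.wf

/-- The measure of a set of projections together with the number `n` of remaining tasks. -/
def networkMeasure (V : Finset (H →ₗ[ℂ] H)) (n : ℕ) : ℕ × Multiset ℕ × ℕ × Multiset ℕ × ℕ :=
  -- The leading number is the stage of the algorithm. The flag precedes the multiset of all ranges
  -- because adding loop projections lowers the flag but enlarges that multiset.
  (3, (maxElements (ranges V)).val.map (fun U : Submodule ℂ H => Module.finrank ℂ U),
    antichainFlag (ranges V), (ranges V).val.map (fun U : Submodule ℂ H => Module.finrank ℂ U), n)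

/-- The measure of a state. -/
def State.measure : State H → ℕ × Multiset ℕ × ℕ × Multiset ℕ × ℕ
  -- The `+ 1` makes the passage to the minimality check a strict descent even when no pair is
  -- unknown.
  | .scattering N => networkMeasure N.projs (N.unknown.card + 1)
  | .minimality V => networkMeasure V 0
  | .completing _ _ todo => (2, 0, 0, 0, todo.card)
  | .constructing _ => (1, 0, 0, 0, 0)
  | .output _ => (0, 0, 0, 0, 0)

theorem strictMono_finrank : StrictMono fun U : Submodule ℂ H => Module.finrank ℂ U :=
  fun _ _ h => Submodule.finrank_lt_finrank_of_lt h

theorem measureRel_scatter {N : Network H} (h : NetworkInvariant A N) {P Q : H →ₗ[ℂ] H}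
    (hPQ : s(P, Q) ∈ N.unknown) :
    measureRel (State.scattering (N.scatter P Q)).measure (State.scattering N).measure := by
  obtain ⟨hP, hQ⟩ := h.unknown_mem P Q hPQ
  have hr := h.refines hP hQ
  apply Prod.Lex.right
  by_cases h1 : maxElements (ranges (N.projsAfter P Q)) = maxElements (ranges N.projs)
  · change Prod.Lex _ _ (Multiset.map _ (maxElements (ranges (N.projsAfter P Q))).val, _) _
    rw [h1]
    apply Prod.Lex.right
    obtain h2 | h2 := (hr.antichainFlag_le h1).lt_or_eq
    · exact Prod.Lex.left _ _ h2
    · change Prod.Lex _ _ (antichainFlag (ranges (N.projsAfter P Q)), _) _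
      rw [h2]
      apply Prod.Lex.right
      by_cases h3 : ranges (N.projsAfter P Q) = ranges N.projs
      · change Prod.Lex _ _ (Multiset.map _ (ranges (N.projsAfter P Q)).val, _) _
        rw [h3]
        apply Prod.Lex.right
        have he := eq_of_ranges_eq (h.generates.projsAfter hP hQ).proj h.generates.proj h3
        exact Nat.succ_lt_succ (Network.card_unknown_scatter_lt hP hQ hPQ he)
      · exact Prod.Lex.left _ _ (hr.dershowitzMannaLT strictMono_finrank h3)
  · exact Prod.Lex.left _ _ (hr.dershowitzMannaLT_maxElements strictMono_finrank h1)

theorem measureRel_addLoopProjections {V : Finset (H →ₗ[ℂ] H)} (h : ProperNetwork A V) {P Q : V}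
    {w w' : (graph V).Walk P Q} (hw : ¬ Proportional w w') :
    measureRel (State.scattering (addLoopProjections w w')).measure
      (State.minimality V).measure := by
  apply Prod.Lex.right
  rw [h.maxElements_addLoopProjections w w' hw, h.maxElements_ranges]
  apply Prod.Lex.right
  rw [h.antichainFlag_addLoopProjections w w' hw, antichainFlag, if_pos h.maxElements_ranges]
  exact Prod.Lex.left _ _ Nat.zero_lt_one

end Termination

/-! ### Minimal networks -/

section Minimal

variable {A : NonUnitalStarSubalgebra ℂ (H →ₗ[ℂ] H)} {V : Finset (H →ₗ[ℂ] H)}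

/-- The vertices of `V` are minimal projections of the algebra `A` that they generate. -/
structure MinimalNetwork (A : NonUnitalStarSubalgebra ℂ (H →ₗ[ℂ] H)) (V : Finset (H →ₗ[ℂ] H)) :
    Prop extends Generates A V where
  minimal : ∀ P ∈ V, ∀ T ∈ A, ∃ c : ℂ, P * T * P = c • P

/-- A subspace that contains `1` and is invariant under left multiplication by the self-adjoint
generators of a nonunital star algebra contains this algebra. -/
theorem adjoin_le_of_left_invariant {s : Set (H →ₗ[ℂ] H)} (hs : ∀ R ∈ s, IsSelfAdjoint R)
    {Y : Submodule ℂ (H →ₗ[ℂ] H)} (h1 : 1 ∈ Y) (hY : ∀ R ∈ s, ∀ x ∈ Y, R * x ∈ Y)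
    {T : H →ₗ[ℂ] H} (hT : T ∈ NonUnitalStarAlgebra.adjoin ℂ s) : T ∈ Y := by
  have hT' : T ∈ NonUnitalAlgebra.adjoin ℂ (s ∪ star s) := hT
  have hss : s ∪ star s = s := by
    refine Set.union_eq_self_of_subset_right fun R hR => ?_
    have := hs _ hR
    rw [IsSelfAdjoint, star_star] at this
    rw [this]
    exact hR
  rw [hss] at hT'
  -- The operators that map `Y` into itself by left multiplication form an algebra, so it suffices
  -- to test the generators; evaluation at `1` follows.
  have key : ∀ x ∈ Y, T * x ∈ Y := by
    clear hT
    induction hT' using NonUnitalAlgebra.adjoin_induction with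
    | mem R hR => exact hY R hR
    | add a b _ _ ha hb => intro x hx; rw [add_mul]; exact add_mem (ha x hx) (hb x hx)
    | zero => intro x _; rw [zero_mul]; exact zero_mem _
    | mul a b _ _ ha hb => intro x hx; rw [mul_assoc]; exact ha _ (hb x hx)
    | smul c a _ ha => intro x hx; rw [smul_mul_assoc]; exact Y.smul_mem c (ha x hx)
  simpa using key 1 h1

/-- The span of the path isometries from `P` to `Q`. -/
def pathSpan (P Q : V) : Submodule ℂ (H →ₗ[ℂ] H) :=
  Submodule.span ℂ (Set.range fun w : (graph V).Walk P Q => pathIsometry w)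

/-- Multiplying a path isometry by a vertex leaves it unchanged, kills it, or prolongs its walk by
one edge up to a factor. -/
theorem ProperNetwork.mul_mem_pathSpan (h : ProperNetwork A V) {P R Q : V} {x : H →ₗ[ℂ] H}
    (hx : x ∈ pathSpan R Q) : (P : H →ₗ[ℂ] H) * x ∈ pathSpan P Q := by
  have : pathSpan R Q ≤ (pathSpan P Q).comap (LinearMap.mulLeft ℂ (P : H →ₗ[ℂ] H)) := by
    refine Submodule.span_le.2 ?_
    rintro _ ⟨w, rfl⟩
    change (P : H →ₗ[ℂ] H) * pathIsometry w ∈ pathSpan P Q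
    by_cases he : P = R
    · subst he
      rw [h.mul_pathIsometry]
      exact Submodule.subset_span ⟨w, rfl⟩
    by_cases h0 : (P : H →ₗ[ℂ] H) * R = 0
    · rw [← h.mul_pathIsometry w, ← mul_assoc, h0, zero_mul]
      exact zero_mem _
    · obtain ⟨c, hc⟩ := h.exists_mul_pathIsometry (h.adj_iff.2 ⟨he, h0⟩) w
      rw [hc]
      exact Submodule.smul_mem _ _ (Submodule.subset_span ⟨_, rfl⟩)
  exact this hx

theorem ProperNetwork.conj_mem_pathSpan (h : ProperNetwork A V) {T : H →ₗ[ℂ] H} (hT : T ∈ A)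
    (P Q : V) : (P : H →ₗ[ℂ] H) * T * Q ∈ pathSpan P Q := by
  -- The end point `Q` is fixed and the initial point varies: left multiplication by a vertex `R`
  -- moves the initial point through `R`, so the condition has to hold for all initial points at
  -- once.
  let Y : Submodule ℂ (H →ₗ[ℂ] H) := ⨅ P : V, (pathSpan P Q).comap
    (LinearMap.mulLeft ℂ (P : H →ₗ[ℂ] H) ∘ₗ LinearMap.mulRight ℂ (Q : H →ₗ[ℂ] H))
  have hY : ∀ x, x ∈ Y ↔ ∀ P : V, (P : H →ₗ[ℂ] H) * (x * Q) ∈ pathSpan P Q := by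
    intro x
    simp [Y, Submodule.mem_iInf]
  have hTY : T ∈ Y := by
    rw [← h.adjoin_eq] at hT
    refine adjoin_le_of_left_invariant (fun R hR => (h.proj R hR).isSelfAdjoint) ?_ ?_ hT
    · rw [hY]
      intro P
      rw [one_mul]
      apply h.mul_mem_pathSpan (R := Q)
      rw [← pathIsometry_nil Q]
      exact Submodule.subset_span ⟨_, rfl⟩
    · intro R hR x hx
      rw [hY] at hx ⊢
      intro P
      rw [mul_assoc]
      exact h.mul_mem_pathSpan (hx ⟨R, hR⟩)
  rw [mul_assoc]
  exact (hY T).1 hTY P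

/-- Path independence compares every closed walk at `P` with the trivial one, whose path isometry is
`P`; so the path span from `P` to `P` is `ℂ P`. -/
theorem ProperNetwork.minimalNetwork (h : ProperNetwork A V) (hV : PathIndependent V) :
    MinimalNetwork A V := by
  refine ⟨h.toGenerates, fun P hP T hT => ?_⟩
  have hle : pathSpan (⟨P, hP⟩ : V) ⟨P, hP⟩ ≤ Submodule.span ℂ {P} := by
    refine Submodule.span_le.2 ?_
    rintro _ ⟨w, rfl⟩
    obtain ⟨c, hc⟩ := hV _ _ w SimpleGraph.Walk.nil
    rw [pathIsometry_nil] at hc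
    exact Submodule.mem_span_singleton.2 ⟨c, hc.symm⟩
  obtain ⟨c, hc⟩ := Submodule.mem_span_singleton.1
    (hle (h.conj_mem_pathSpan hT ⟨P, hP⟩ ⟨P, hP⟩))
  exact ⟨c, hc.symm⟩

theorem conj_eq_of_conj_eq_smul {P X : H →ₗ[ℂ] H} (hP : IsStarProjection P) (h0 : P ≠ 0)
    (hX : IsSelfAdjoint X) {c : ℂ} (h : P * X * P = c • P) : star c = c := by
  have h1 := congrArg star h
  simp only [star_mul, star_smul, hP.isSelfAdjoint.star_eq, hX.star_eq] at h1
  rw [← mul_assoc, h, ← sub_eq_zero, ← sub_smul] at h1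
  exact (sub_eq_zero.1 ((smul_eq_zero.1 h1).resolve_right h0)).symm

theorem MinimalNetwork.properNetwork (h : MinimalNetwork A V) : ProperNetwork A V := by
  refine ⟨h.toGenerates, fun P hP Q hQ _ => ?_⟩
  have hPs := h.proj P hP
  have hQs := h.proj Q hQ
  by_cases h0 : P * Q = 0
  · exact reflecting_of_mul_eq_zero hPs.isSelfAdjoint hQs.isSelfAdjoint h0
  obtain ⟨c, hc⟩ := h.minimal P hP Q (h.mem hQ)
  obtain ⟨d, hd⟩ := h.minimal Q hQ P (h.mem hP)
  -- Both coefficients are read off from `P Q P Q`, bracketed in two ways.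
  have hcd : c = d := by
    have h1 : P * Q * P * Q = c • (P * Q) := by rw [hc, smul_mul_assoc]
    have h2 : P * Q * P * Q = d • (P * Q) := by
      rw [mul_assoc P Q P, mul_assoc P, hd, mul_smul_comm]
    rw [h1, ← sub_eq_zero, ← sub_smul] at h2
    exact sub_eq_zero.1 ((smul_eq_zero.1 h2).resolve_right h0)
  have hre : ((c.re : ℝ) : ℂ) = c := Complex.conj_eq_iff_re.1
    (conj_eq_of_conj_eq_smul hPs (h.ne_zero P hP) hQs.isSelfAdjoint hc)
  exact ⟨c.re, by rw [hre]; exact hc, by rw [hre, hcd]; exact hd⟩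

/-! ### Completion -/

/-- `1` need not lie in `A`, but in the expansion every term contains `T`. -/
theorem compl_mul_mul_compl_mem {I T : H →ₗ[ℂ] H} (hI : I ∈ A) (hT : T ∈ A) :
    (1 - I) * T * (1 - I) ∈ A := by
  have : (1 - I) * T * (1 - I) = T - I * T - T * I + I * T * I := by noncomm_ring
  rw [this]
  exact add_mem (sub_mem (sub_mem hT (mul_mem hI hT)) (mul_mem hT hI)) (mul_mem (mul_mem hI hT) hI)

theorem exists_isMaxIndependentSet (V : Finset (H →ₗ[ℂ] H)) :
    ∃ S, IsMaxIndependentSet V S := by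
  obtain ⟨S, hS, hmax⟩ := (V.powerset.filter PairwiseOrthogonal).exists_max_image Finset.card
    ⟨∅, by simp [PairwiseOrthogonal]⟩
  simp only [Finset.mem_filter, Finset.mem_powerset] at hS hmax
  exact ⟨S, hS.1, hS.2, fun T hT hT' => hmax T ⟨hT, hT'⟩⟩

/-- The invariant of the completion loop. -/
structure CompletionInvariant (A : NonUnitalStarSubalgebra ℂ (H →ₗ[ℂ] H))
    (V S todo : Finset (H →ₗ[ℂ] H)) : Prop extends MinimalNetwork A V where
  subset : S ⊆ V
  orthogonal : PairwiseOrthogonal S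
  todo_subset : todo ⊆ V
  covered : ∀ P ∈ V, P ∉ todo → sumAll S * P = P

namespace CompletionInvariant

variable {S todo : Finset (H →ₗ[ℂ] H)} (h : CompletionInvariant A V S todo)
include h

theorem isStarProjection_sumAll : IsStarProjection (sumAll S) :=
  IrrepDecomp.isStarProjection_sumAll (fun P hP => h.proj P (h.subset hP)) h.orthogonal

theorem sumAll_mem : sumAll S ∈ A := IrrepDecomp.sumAll_mem fun _ hP => h.mem (h.subset hP)

theorem exists_conj_compl {P : H →ₗ[ℂ] H} (hP : P ∈ V) (hne : sumAll S * P ≠ P) :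
    ∃ c : ℂ, c ≠ 0 ∧ star c = c ∧ P * (1 - sumAll S) * P = c • P := by
  have hPs := h.proj P hP
  have hK := h.isStarProjection_sumAll.one_sub
  obtain ⟨d, hd⟩ := h.minimal P hP _ h.sumAll_mem
  have hc : P * (1 - sumAll S) * P = (1 - d) • P := by
    rw [mul_sub, sub_mul, hd, mul_one, hPs.isIdempotentElem.eq, sub_smul, one_smul]
  refine ⟨1 - d, ?_, conj_eq_of_conj_eq_smul hPs (h.ne_zero P hP) hK.isSelfAdjoint hc, hc⟩
  intro h0
  rw [h0, zero_smul] at hc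
  -- With `K = 1 - sumAll S`, a vanishing coefficient means `(K P)† (K P) = P K P = 0`, so `P` would
  -- already be covered.
  have h1 : (1 - sumAll S) * P = 0 := by
    apply eq_zero_of_star_mul_self
    rw [star_mul, hPs.isSelfAdjoint.star_eq, hK.isSelfAdjoint.star_eq, mul_assoc,
      ← mul_assoc (1 - sumAll S) (1 - sumAll S), hK.isIdempotentElem.eq, ← mul_assoc, hc]
  rw [sub_mul, one_mul, sub_eq_zero] at h1
  exact hne h1.symm

theorem conj_compl_mul_self {P : H →ₗ[ℂ] H} {c : ℂ} (hc : P * (1 - sumAll S) * P = c • P) :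
    (1 - sumAll S) * P * (1 - sumAll S) * ((1 - sumAll S) * P * (1 - sumAll S)) =
      c • ((1 - sumAll S) * P * (1 - sumAll S)) := by
  have hK := h.isStarProjection_sumAll.one_sub.isIdempotentElem.eq
  set K := 1 - sumAll S
  calc K * P * K * (K * P * K) = K * (P * (K * K) * P) * K := by simp only [mul_assoc]
    _ = c • (K * P * K) := by rw [hK, hc, mul_smul_comm, smul_mul_assoc]

theorem exists_isComplementaryProj {P : H →ₗ[ℂ] H} (hP : P ∈ V) (hne : sumAll S * P ≠ P) :
    ∃ T, IsComplementaryProj S P T := by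
  obtain ⟨c, hc0, hcs, hc⟩ := h.exists_conj_compl hP hne
  refine ⟨c⁻¹ • ((1 - sumAll S) * P * (1 - sumAll S)), ⟨?_, ?_⟩, c, hc0, rfl⟩
  · change _ * _ = _
    rw [smul_mul_smul_comm, h.conj_compl_mul_self hc, smul_smul, mul_assoc, inv_mul_cancel₀ hc0,
      mul_one]
  · have hK := h.isStarProjection_sumAll.one_sub.isSelfAdjoint.star_eq
    rw [IsSelfAdjoint, star_smul, star_mul, star_mul, hK, (h.proj P hP).isSelfAdjoint.star_eq,
      star_inv₀, hcs, mul_assoc]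

section Complement

variable {P T : H →ₗ[ℂ] H} (hP : P ∈ V) (hne : sumAll S * P ≠ P) (hT : IsComplementaryProj S P T)
include hT

theorem sumAll_mul_complement : sumAll S * T = 0 := by
  obtain ⟨-, c, -, rfl⟩ := hT
  rw [mul_smul_comm, ← mul_assoc, ← mul_assoc, h.isStarProjection_sumAll.mul_one_sub_self,
    zero_mul, zero_mul, smul_zero]

theorem complement_mul_of_covered {X : H →ₗ[ℂ] H} (hX : sumAll S * X = X) : T * X = 0 := by
  have := mul_eq_zero_symm h.isStarProjection_sumAll.isSelfAdjoint hT.1.isSelfAdjoint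
    (h.sumAll_mul_complement hT)
  rw [← hX, ← mul_assoc, this, zero_mul]

include hP

theorem complement_mem : T ∈ A := by
  obtain ⟨-, c, -, rfl⟩ := hT
  exact SMulMemClass.smul_mem _ (compl_mul_mul_compl_mem h.sumAll_mem (h.mem hP))

include hne

theorem complement_ne_zero : T ≠ 0 := by
  obtain ⟨d, hd0, -, hd⟩ := h.exists_conj_compl hP hne
  obtain ⟨-, c, hc, rfl⟩ := hT
  intro h0
  have h1 := (smul_eq_zero.1 h0).resolve_left (inv_ne_zero hc)
  have h2 : (P * (1 - sumAll S) * P) * (P * (1 - sumAll S) * P) =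
      P * ((1 - sumAll S) * P * (1 - sumAll S)) * P := by
    have := (h.proj P hP).isIdempotentElem.eq
    calc _ = P * (1 - sumAll S) * (P * P) * (1 - sumAll S) * P := by simp only [mul_assoc]
      _ = _ := by rw [this]; simp only [mul_assoc]
  rw [h1, hd, mul_zero, zero_mul, smul_mul_smul_comm, (h.proj P hP).isIdempotentElem.eq] at h2
  exact (smul_ne_zero (mul_ne_zero hd0 hd0) (h.ne_zero P hP)) h2

/-- Idempotence of `T ≠ 0` forces the normalising factor to be the coefficient in `P K P = d P`, `K
= 1 - sumAll S`; hence `T P = d⁻¹ K (P K P) = K P`. Consequently adding `T` to the orthogonal set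
covers `P`. -/
theorem complement_mul : T * P = (1 - sumAll S) * P := by
  have hT0 := h.complement_ne_zero hP hne hT
  obtain ⟨d, hd0, -, hd⟩ := h.exists_conj_compl hP hne
  obtain ⟨hTs, c, hc, rfl⟩ := hT
  have h1 : _ * _ = _ := hTs.isIdempotentElem
  rw [smul_mul_smul_comm, h.conj_compl_mul_self hd, smul_smul, ← sub_eq_zero, ← sub_smul] at h1
  have h2 : c⁻¹ * c⁻¹ * d - c⁻¹ = 0 :=
    (smul_eq_zero.1 h1).resolve_right fun h0 => hT0 (by rw [h0, smul_zero])
  have h3 : c⁻¹ * d = 1 := by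
    have : c⁻¹ * (c⁻¹ * d - 1) = 0 := by rw [← h2]; ring
    exact sub_eq_zero.1 ((mul_eq_zero.1 this).resolve_left (inv_ne_zero hc))
  rw [smul_mul_assoc, mul_assoc (1 - sumAll S), mul_assoc (1 - sumAll S), hd, mul_smul_comm,
    smul_smul, h3, one_smul]

theorem minimalNetwork_insert : MinimalNetwork A (insert T V) where
  proj X hX := by
    obtain rfl | hX := Finset.mem_insert.1 hX
    · exact hT.1
    · exact h.proj X hX
  ne_zero X hX := by
    obtain rfl | hX := Finset.mem_insert.1 hX
    · exact h.complement_ne_zero hP hne hT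
    · exact h.ne_zero X hX
  adjoin_eq := by
    apply adjoin_eq_of_subset h.adjoin_eq
    · intro X hX
      obtain rfl | hX := Finset.mem_insert.1 hX
      · exact h.complement_mem hP hT
      · exact h.mem hX
    · intro X hX
      exact NonUnitalStarAlgebra.subset_adjoin ℂ _ (Finset.mem_insert_of_mem hX)
  minimal X hX a ha := by
    obtain rfl | hX := Finset.mem_insert.1 hX
    · obtain ⟨hTs, c, hc, rfl⟩ := hT
      obtain ⟨d, hd⟩ := h.minimal P hP _ (compl_mul_mul_compl_mem h.sumAll_mem ha)
      set K := 1 - sumAll S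
      refine ⟨c⁻¹ * d, ?_⟩
      -- Minimality passes from `P` to its complement because the compressed operator `K a K` again
      -- lies in `A`.
      have h1 : K * P * K * a * (K * P * K) = d • (K * P * K) := by
        calc K * P * K * a * (K * P * K) = K * (P * (K * a * K) * P) * K := by
              simp only [mul_assoc]
          _ = d • (K * P * K) := by rw [hd, mul_smul_comm, smul_mul_assoc]
      rw [smul_mul_assoc, smul_mul_smul_comm, h1, smul_smul, smul_smul]
      congr 1
      ring
    · exact h.minimal X hX a ha

theorem insert_complement : CompletionInvariant A (insert T V) (insert T S) (todo.erase P) := by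
  have hTS : T ∉ S := by
    intro hTS
    have h1 := sumAll_mul_of_mem (fun P hP => h.proj P (h.subset hP)) h.orthogonal hTS
    rw [h.sumAll_mul_complement hT] at h1
    exact h.complement_ne_zero hP hne hT h1.symm
  have hsum : sumAll (insert T S) = T + sumAll S := Finset.sum_insert hTS
  have hTX : ∀ X ∈ S, T * X = 0 := fun X hX => h.complement_mul_of_covered hT
    (sumAll_mul_of_mem (fun P hP => h.proj P (h.subset hP)) h.orthogonal hX)
  refine ⟨h.minimalNetwork_insert hP hne hT, Finset.insert_subset_insert _ h.subset, ?_, ?_, ?_⟩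
  · intro X hX Y hY hXY
    obtain hX | hX' := Finset.mem_insert.1 hX <;> obtain hY | hY' := Finset.mem_insert.1 hY
    · exact absurd (hX.trans hY.symm) hXY
    · rw [hX]; exact hTX Y hY'
    · rw [hY]
      exact mul_eq_zero_symm hT.1.isSelfAdjoint (h.proj X (h.subset hX')).isSelfAdjoint (hTX X hX')
    · exact h.orthogonal hX' hY' hXY
  · exact (Finset.erase_subset _ _).trans (h.todo_subset.trans (Finset.subset_insert _ _))
  · intro X hX hXt
    rw [hsum, add_mul]
    obtain rfl | hX := Finset.mem_insert.1 hX
    · rw [h.sumAll_mul_complement hT, hT.1.isIdempotentElem.eq, add_zero]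
    by_cases hXP : X = P
    · subst hXP
      rw [h.complement_mul hP hne hT, sub_mul, one_mul, sub_add_cancel]
    · have hc := h.covered X hX fun hx => hXt (Finset.mem_erase.2 ⟨hXP, hx⟩)
      rw [hc, h.complement_mul_of_covered hT hc, zero_add]

end Complement

theorem erase_of_covered {P : H →ₗ[ℂ] H} (hP : sumAll S * P = P) :
    CompletionInvariant A V S (todo.erase P) := by
  refine ⟨h.toMinimalNetwork, h.subset, h.orthogonal, (Finset.erase_subset _ _).trans h.todo_subset,
    fun X hX hXt => ?_⟩
  by_cases hXP : X = P
  · rw [hXP, hP]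
  · exact h.covered X hX fun hx => hXt (Finset.mem_erase.2 ⟨hXP, hx⟩)

end CompletionInvariant

theorem MinimalNetwork.completionInvariant (h : MinimalNetwork A V) {S : Finset (H →ₗ[ℂ] H)}
    (hS : IsMaxIndependentSet V S) : CompletionInvariant A V S (V \ S) := by
  refine ⟨h, hS.1, hS.2.1, Finset.sdiff_subset, fun P hP hPt => ?_⟩
  refine sumAll_mul_of_mem (fun P hP => h.proj P (hS.1 hP)) hS.2.1 ?_
  by_contra hPS
  exact hPt (Finset.mem_sdiff.2 ⟨hP, hPS⟩)

/-- The vertices of `V` are minimal projections, and some pairwise orthogonal ones among them add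
up to a unit of the algebra. -/
def Complete (A : NonUnitalStarSubalgebra ℂ (H →ₗ[ℂ] H)) (V : Finset (H →ₗ[ℂ] H)) : Prop :=
  ∃ S, CompletionInvariant A V S ∅

end Minimal

/-! ### The invariant of the algorithm -/

/-- The invariant of the algorithm. -/
def State.Invariant (A : NonUnitalStarSubalgebra ℂ (H →ₗ[ℂ] H)) : State H → Prop
  | .scattering N => NetworkInvariant A N
  | .minimality V => ProperNetwork A V
  | .completing V S todo => CompletionInvariant A V S todo
  | .constructing V => Complete A V
  | .output B => ∃ V, Complete A V ∧ ConstructsIrrepBasis V B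

theorem Step.invariant {A : NonUnitalStarSubalgebra ℂ (H →ₗ[ℂ] H)} {s t : State H} (h : Step s t)
    (hs : s.Invariant A) : t.Invariant A := by
  cases h with
  | scatter N P Q hu =>
    obtain ⟨hP, hQ⟩ := NetworkInvariant.unknown_mem hs P Q hu
    exact NetworkInvariant.scatter hs hP hQ
  | allReflecting N hu =>
    have hs : NetworkInvariant A N := hs
    exact ⟨hs.generates, fun X hX Y hY hne => hs.reflecting X hX Y hY hne (by simp [hu])⟩
  | notMinimal V P Q w w' _ => exact ProperNetwork.networkInvariant_addLoopProjections hs w w'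
  | minimal V S hV hS => exact (ProperNetwork.minimalNetwork hs hV).completionInvariant hS
  | covered V S todo P _ hP => exact CompletionInvariant.erase_of_covered hs hP
  | complement V S todo P T hP hne hT =>
    exact CompletionInvariant.insert_complement hs
      (CompletionInvariant.todo_subset hs hP) hne hT
  | complete V S => exact ⟨S, hs⟩
  | construct V B hB => exact ⟨V, hs, hB⟩

theorem Step.measureRel {A : NonUnitalStarSubalgebra ℂ (H →ₗ[ℂ] H)} {s t : State H} (h : Step s t)
    (hs : s.Invariant A) : measureRel t.measure s.measure := by
  cases h with
  | scatter N P Q hu => exact measureRel_scatter hs hu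
  | allReflecting N hu =>
    refine Prod.Lex.right _ (Prod.Lex.right _ (Prod.Lex.right _ (Prod.Lex.right _ ?_)))
    exact Nat.succ_pos _
  | notMinimal V P Q w w' hw => exact measureRel_addLoopProjections hs hw
  | minimal V S _ _ => exact Prod.Lex.left _ _ (by norm_num)
  | covered V S todo P hP _ =>
    refine Prod.Lex.right _ (Prod.Lex.right _ (Prod.Lex.right _ (Prod.Lex.right _ ?_)))
    exact Finset.card_erase_lt_of_mem hP
  | complement V S todo P T hP _ _ =>
    refine Prod.Lex.right _ (Prod.Lex.right _ (Prod.Lex.right _ (Prod.Lex.right _ ?_)))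
    exact Finset.card_erase_lt_of_mem hP
  | complete V S => exact Prod.Lex.left _ _ (by norm_num)
  | construct V B _ => exact Prod.Lex.left _ _ (by norm_num)

theorem Reachable.invariant {𝓜 : Finset (H →ₗ[ℂ] H)} (h𝓜 : ∀ M ∈ 𝓜, IsSelfAdjoint M) {s : State H}
    (h : Reachable 𝓜 s) :
    s.Invariant (NonUnitalStarAlgebra.adjoin ℂ (𝓜 : Set (H →ₗ[ℂ] H))) := by
  obtain ⟨s₀, ⟨N, hN, rfl⟩, hr⟩ := h
  induction hr with
  | refl => exact hN.networkInvariant h𝓜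
  | tail _ hst ih => exact hst.invariant ih

theorem not_exists_infinite_run {𝓜 : Finset (H →ₗ[ℂ] H)} (h𝓜 : ∀ M ∈ 𝓜, IsSelfAdjoint M) :
    ¬ ∃ f : ℕ → State H, Initial 𝓜 (f 0) ∧ ∀ n, Step (f n) (f (n + 1)) := by
  rintro ⟨f, h0, hf⟩
  have hr : ∀ n, Reachable 𝓜 (f n) := by
    intro n
    refine ⟨f 0, h0, ?_⟩
    induction n with
    | zero => exact Relation.ReflTransGen.refl
    | succ n ih => exact ih.tail (hf n)
  have : ∀ n, IrrepDecomp.measureRel (f (n + 1)).measure (f n).measure := fun n =>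
    (hf n).measureRel ((hr n).invariant h𝓜)
  exact (wellFounded_iff_isEmpty_descending_chain.1 wellFounded_measureRel).false
    ⟨fun n => (f n).measure, this⟩

theorem exists_initial (𝓜 : Finset (H →ₗ[ℂ] H)) : ∃ s, Initial 𝓜 s :=
  ⟨_, ⟨allSpectralProjections 𝓜, pairs (allSpectralProjections 𝓜)⟩,
    ⟨rfl, subset_rfl, fun _ hP _ hQ hne hu => absurd (mem_pairs.2 ⟨hP, hQ, hne⟩) hu⟩, rfl⟩

/-! ### Existence of the table -/

section Construct

variable {A : NonUnitalStarSubalgebra ℂ (H →ₗ[ℂ] H)} {V : Finset (H →ₗ[ℂ] H)}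

theorem exists_walk_of_mem_component {C : (graph V).ConnectedComponent} {P Q : V}
    (hP : (P : H →ₗ[ℂ] H) ∈ component V C) (hQ : (Q : H →ₗ[ℂ] H) ∈ component V C) :
    Nonempty ((graph V).Walk P Q) := by
  obtain ⟨hP', h1⟩ := mem_component.1 hP
  obtain ⟨hQ', h2⟩ := mem_component.1 hQ
  exact SimpleGraph.ConnectedComponent.exact (h1.trans h2.symm)

theorem exists_orthonormal_span_eq (U : Submodule ℂ H) :
    ∃ (n : ℕ) (e : Fin n → H), Orthonormal ℂ e ∧ Submodule.span ℂ (Set.range e) = U := by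
  let b := stdOrthonormalBasis ℂ U
  refine ⟨_, fun i => (b i : H), b.orthonormal.comp_linearIsometry U.subtypeₗᵢ, ?_⟩
  have h1 : Set.range (fun i => (b i : H)) = U.subtype '' Set.range b := by
    rw [← Set.range_comp]; rfl
  have h2 := b.toBasis.span_eq
  rw [b.coe_toBasis] at h2
  rw [h1, ← Submodule.map_span, h2, Submodule.map_top, Submodule.range_subtype]

theorem exists_constructsIrrepBasis (V : Finset (H →ₗ[ℂ] H)) :
    ∃ B : BPT H, ConstructsIrrepBasis V B := by
  have key : ∀ C : (graph V).ConnectedComponent, ∃ (n m : ℕ) (e : Fin n → Fin m → H)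
      (col : Fin m → V) (k₁ : Fin m),
      Function.Injective col ∧
      IsMaxIndependentSet (component V C) (Finset.univ.image fun k => (col k : H →ₗ[ℂ] H)) ∧
      Orthonormal ℂ (fun i => e i k₁) ∧
      Submodule.span ℂ (Set.range fun i => e i k₁) = LinearMap.range (col k₁ : H →ₗ[ℂ] H) ∧
      ∀ k, k ≠ k₁ → ∃ w : (graph V).Walk (col k) (col k₁),
        ∀ i, e i k = pathIsometry w (e i k₁) := by
    intro C
    obtain ⟨S, hS⟩ := exists_isMaxIndependentSet (component V C)
    have hSV : ∀ P ∈ S, P ∈ V := fun P hP => (mem_component.1 (hS.1 hP)).1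
    have hne : 0 < S.card := by
      obtain ⟨P, rfl⟩ := C.exists_rep
      -- A single vertex is an orthogonal set, so a largest one is nonempty and a distinguished
      -- column exists.
      have := hS.2.2 {(P : H →ₗ[ℂ] H)}
        (Finset.singleton_subset_iff.2 (mem_component.2 ⟨P.2, rfl⟩)) (by simp [PairwiseOrthogonal])
      simpa using this
    let col : Fin S.card → V := fun k => ⟨S.equivFin.symm k, hSV _ (S.equivFin.symm k).2⟩
    have hcol : ∀ k, (col k : H →ₗ[ℂ] H) ∈ component V C := fun k => hS.1 (S.equivFin.symm k).2
    let k₁ : Fin S.card := ⟨0, hne⟩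
    obtain ⟨n, f, hf, hfs⟩ := exists_orthonormal_span_eq (LinearMap.range (col k₁ : H →ₗ[ℂ] H))
    let w : ∀ k, (graph V).Walk (col k) (col k₁) := fun k =>
      (exists_walk_of_mem_component (hcol k) (hcol k₁)).some
    refine ⟨n, S.card, fun i k => if k = k₁ then f i else pathIsometry (w k) (f i), col, k₁,
      ?_, ?_, ?_, ?_, ?_⟩
    · intro k l hkl
      exact S.equivFin.symm.injective (Subtype.ext (congrArg (fun z : V => (z : H →ₗ[ℂ] H)) hkl))
    · convert hS
      ext P
      simp only [Finset.mem_image, Finset.mem_univ, true_and]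
      constructor
      · rintro ⟨k, rfl⟩
        exact (S.equivFin.symm k).2
      · intro hP
        exact ⟨S.equivFin ⟨P, hP⟩, by simp [col]⟩
    · simpa using hf
    · simpa using hfs
    · intro k hk
      exact ⟨w k, fun i => by simp [hk]⟩
  choose n m e col k₁ hB using key
  have : Finite (graph V).ConnectedComponent := Quot.finite _
  obtain ⟨N, ⟨comp⟩⟩ := Finite.exists_equiv_fin (graph V).ConnectedComponent
  exact ⟨⟨N, fun q => n (comp.symm q), fun q => m (comp.symm q), fun q => e (comp.symm q)⟩,
    comp.symm, fun q => ⟨col (comp.symm q), k₁ (comp.symm q), hB (comp.symm q)⟩⟩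

/-! ### Progress from every state that is not an output -/

theorem not_stuck {A : NonUnitalStarSubalgebra ℂ (H →ₗ[ℂ] H)} {s : State H} (h : s.Invariant A) :
    (∃ B, s = .output B) ∨ ∃ s', Step s s' := by
  cases s with
  | scattering N =>
    right
    obtain hu | ⟨z, hz⟩ := N.unknown.eq_empty_or_nonempty
    · exact ⟨_, .allReflecting N hu⟩
    · induction z using Sym2.ind with
      | _ P Q => exact ⟨_, .scatter N P Q hz⟩
  | minimality V =>
    right
    by_cases hV : PathIndependent V
    · obtain ⟨S, hS⟩ := exists_isMaxIndependentSet V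
      exact ⟨_, .minimal V S hV hS⟩
    · unfold PathIndependent at hV
      push Not at hV
      obtain ⟨P, Q, w, w', hw⟩ := hV
      exact ⟨_, .notMinimal V P Q w w' hw⟩
  | completing V S todo =>
    right
    obtain rfl | ⟨P, hP⟩ := todo.eq_empty_or_nonempty
    · exact ⟨_, .complete V S⟩
    · by_cases hPS : sumAll S * P = P
      · exact ⟨_, .covered V S todo P hP hPS⟩
      · obtain ⟨T, hT⟩ := CompletionInvariant.exists_isComplementaryProj h
          (CompletionInvariant.todo_subset h hP) hPS
        exact ⟨_, .complement V S todo P T hP hPS hT⟩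
  | constructing V =>
    right
    obtain ⟨B, hB⟩ := exists_constructsIrrepBasis V
    exact ⟨_, .construct V B hB⟩
  | output B => exact Or.inl ⟨B, rfl⟩

/-! ### Maximum independent sets of components -/

/-- `P Q P` and `Q P Q` have equal traces by cyclicity, and the common nonzero coefficient cancels.
So ranks are constant on components. -/
theorem ProperNetwork.trace_eq_of_adj (h : ProperNetwork A V) {P Q : V} (a : (graph V).Adj P Q) :
    LinearMap.trace ℂ H P = LinearMap.trace ℂ H Q := by
  have hl : ((reflCoeff (P : H →ₗ[ℂ] H) Q : ℝ) : ℂ) ≠ 0 :=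
    Complex.ofReal_ne_zero.2 (h.reflCoeff_pos a).ne'
  have hP := (h.proj P P.2).isIdempotentElem.eq
  have hQ := (h.proj Q Q.2).isIdempotentElem.eq
  have h1 : LinearMap.trace ℂ H ((P : H →ₗ[ℂ] H) * Q * P) =
      LinearMap.trace ℂ H ((Q : H →ₗ[ℂ] H) * P * Q) := by
    rw [LinearMap.trace_mul_comm, ← mul_assoc, hP, mul_assoc (Q : H →ₗ[ℂ] H),
      LinearMap.trace_mul_comm ℂ (Q : H →ₗ[ℂ] H), mul_assoc, hQ]
  rw [(h.reflectWith_of_adj a).1, (h.reflectWith_of_adj a).2, map_smul, map_smul, smul_eq_mul,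
    smul_eq_mul] at h1
  exact mul_left_cancel₀ hl h1

theorem ProperNetwork.trace_eq_of_walk (h : ProperNetwork A V) {P Q : V}
    (w : (graph V).Walk P Q) : LinearMap.trace ℂ H P = LinearMap.trace ℂ H Q := by
  induction w with
  | nil => rfl
  | cons a w ih => rw [h.trace_eq_of_adj a, ih]

theorem trace_eq_finrank {P : H →ₗ[ℂ] H} (hP : IsStarProjection P) :
    LinearMap.trace ℂ H P = (Module.finrank ℂ (LinearMap.range P) : ℂ) :=
  (LinearMap.IsIdempotentElem.isProj_range _ hP.isIdempotentElem).trace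

/-- The part `S'` of the complete set inside the component adds up to a unit for it, so `sumAll S' -
sumAll M` is a projection. All vertices of the component have the same rank and `M` has at least as
many elements as `S'`; hence this projection has rank zero. -/
theorem CompletionInvariant.sumAll_mul_of_isMaxIndependentSet {S : Finset (H →ₗ[ℂ] H)}
    (h : CompletionInvariant A V S ∅) {C : (graph V).ConnectedComponent}
    {M : Finset (H →ₗ[ℂ] H)} (hM : IsMaxIndependentSet (component V C) M) {P : H →ₗ[ℂ] H}
    (hP : P ∈ component V C) : sumAll M * P = P := by
  have hp := h.properNetwork
  have hCV : ∀ X ∈ component V C, X ∈ V := fun X hX => (mem_component.1 hX).1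
  set S' := S.filter fun X => X ∈ component V C with hS'
  have hS'C : S' ⊆ component V C := fun X hX => (Finset.mem_filter.1 hX).2
  have hS'o : PairwiseOrthogonal S' := h.orthogonal.mono (Finset.filter_subset _ _)
  have hcov : ∀ X ∈ component V C, sumAll S' * X = X := by
    intro X hX
    conv_rhs => rw [← h.covered X (hCV X hX) (Finset.notMem_empty X)]
    rw [sumAll, sumAll, Finset.sum_mul, Finset.sum_mul]
    refine Finset.sum_subset (Finset.filter_subset _ _) fun Y hY hYS => ?_
    refine hp.mul_eq_zero_of_not_mem_component (h.subset hY) hX fun hYC => hYS ?_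
    exact Finset.mem_filter.2 ⟨hY, hYC⟩
  have hS'p := IrrepDecomp.isStarProjection_sumAll (fun X hX => h.proj X (hCV X (hS'C hX))) hS'o
  have hMp := IrrepDecomp.isStarProjection_sumAll (fun X hX => h.proj X (hCV X (hM.1 hX))) hM.2.1
  have hMS : sumAll S' * sumAll M = sumAll M := by
    rw [sumAll.eq_def M, Finset.mul_sum]
    exact Finset.sum_congr rfl fun X hX => hcov X (hM.1 hX)
  have hD := hMp.sub_of_mul_eq_right hS'p hMS
  have htr : ∀ W ⊆ component V C, LinearMap.trace ℂ H (sumAll W) =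
      (W.card * Module.finrank ℂ (LinearMap.range P) : ℕ) := by
    intro W hW
    rw [sumAll, map_sum, Finset.sum_congr rfl (g := fun _ => LinearMap.trace ℂ H P),
      Finset.sum_const, nsmul_eq_mul, trace_eq_finrank (h.proj P (hCV P hP)), Nat.cast_mul]
    intro X hX
    obtain ⟨w⟩ := exists_walk_of_mem_component (P := ⟨X, hCV X (hW hX)⟩) (Q := ⟨P, hCV P hP⟩)
      (hW hX) hP
    exact hp.trace_eq_of_walk w
  have h0 : sumAll S' - sumAll M = 0 := by
    have h1 := trace_eq_finrank hD
    rw [map_sub, htr _ hS'C, htr _ hM.1, sub_eq_iff_eq_add] at h1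
    have h2 : S'.card * Module.finrank ℂ (LinearMap.range P) =
        Module.finrank ℂ (LinearMap.range (sumAll S' - sumAll M)) +
          M.card * Module.finrank ℂ (LinearMap.range P) := by exact_mod_cast h1
    have h3 : S'.card * Module.finrank ℂ (LinearMap.range P) ≤
        M.card * Module.finrank ℂ (LinearMap.range P) :=
      Nat.mul_le_mul_right _ (hM.2.2 S' hS'C hS'o)
    have h4 : Module.finrank ℂ (LinearMap.range (sumAll S' - sumAll M)) = 0 := by omega
    rwa [Submodule.finrank_eq_zero, LinearMap.range_eq_bot] at h4
  rw [← sub_eq_zero.1 h0]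
  exact hcov P hP

/-- There are no walks between different components, so the path span containing the compression is
zero. -/
theorem ProperNetwork.conj_eq_zero_of_component_ne (h : ProperNetwork A V) {T : H →ₗ[ℂ] H}
    (hT : T ∈ A) {C D : (graph V).ConnectedComponent} (hCD : C ≠ D) {P Q : H →ₗ[ℂ] H}
    (hP : P ∈ component V C) (hQ : Q ∈ component V D) : P * T * Q = 0 := by
  obtain ⟨hPV, rfl⟩ := mem_component.1 hP
  obtain ⟨hQV, rfl⟩ := mem_component.1 hQ
  have hmem := h.conj_mem_pathSpan hT ⟨P, hPV⟩ ⟨Q, hQV⟩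
  have : IsEmpty ((graph V).Walk ⟨P, hPV⟩ ⟨Q, hQV⟩) :=
    ⟨fun w => hCD (SimpleGraph.ConnectedComponent.sound ⟨w⟩)⟩
  rw [pathSpan, Set.range_eq_empty, Submodule.span_empty] at hmem
  exact (Submodule.mem_bot ℂ).1 hmem

theorem mul_eq_self_of_mem_adjoin {s : Set (H →ₗ[ℂ] H)} {J : H →ₗ[ℂ] H}
    (h : ∀ R ∈ s, J * R = R) (hs : ∀ R ∈ s, IsSelfAdjoint R)
    {T : H →ₗ[ℂ] H} (hT : T ∈ NonUnitalStarAlgebra.adjoin ℂ s) : J * T = T := by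
  have hT' : T ∈ NonUnitalAlgebra.adjoin ℂ (s ∪ star s) := hT
  clear hT
  induction hT' using NonUnitalAlgebra.adjoin_induction with
  | mem R hR =>
    obtain hR | hR := hR
    · exact h R hR
    · have := hs _ hR
      rw [IsSelfAdjoint, star_star] at this
      rw [this]
      exact h _ hR
  | add a b _ _ ha hb => rw [mul_add, ha, hb]
  | zero => rw [mul_zero]
  | mul a b _ _ ha _ => rw [← mul_assoc, ha]
  | smul c a _ ha => rw [mul_smul_comm, ha]

/-! ### Irrep frames -/

/-- The partial isometries `U q k` of the algebra `A`, with initial projections `E q`, generate the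
table `B` from the orthonormal bases `f q` of the ranges of the minimal projections `E q`. -/
structure IsIrrepFrame (A : NonUnitalStarSubalgebra ℂ (H →ₗ[ℂ] H)) (B : BPT H)
    (U : (q : Fin B.blocks) → Fin (B.cols q) → H →ₗ[ℂ] H) (E : Fin B.blocks → H →ₗ[ℂ] H)
    (f : (q : Fin B.blocks) → Fin (B.rows q) → H) : Prop where
  mem : ∀ q k, U q k ∈ A
  mul_proj : ∀ q k, U q k * E q = U q k
  star_mul_self : ∀ q k, star (U q k) * U q k = E q
  star_mul_of_ne : ∀ q {k l}, k ≠ l → star (U q k) * U q l = 0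
  star_mul_of_block_ne : ∀ {q r} k l, q ≠ r → star (U q k) * U r l = 0
  minimal : ∀ T ∈ A, ∀ q k l, ∃ c : ℂ, star (U q k) * T * U q l = c • E q
  disjoint : ∀ T ∈ A, ∀ {q r} k l, q ≠ r → star (U q k) * T * U r l = 0
  unit : ∀ T ∈ A, (∑ q, ∑ k, U q k * star (U q k)) * T = T
  orthonormal : ∀ q, Orthonormal ℂ (f q)
  span_eq : ∀ q, Submodule.span ℂ (Set.range (f q)) = LinearMap.range (E q)
  apply_eq : ∀ q i k, B.e q i k = U q k (f q i)
  pos : ∀ q, 0 < B.rows q ∧ 0 < B.cols q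

theorem Complete.exists_isIrrepFrame (h : Complete A V) {B : BPT H}
    (hB : ConstructsIrrepBasis V B) : ∃ U E f, IsIrrepFrame A B U E f := by
  obtain ⟨S, h⟩ := h
  have hp := h.properNetwork
  obtain ⟨comp, hB⟩ := hB
  choose col k₁ hinj hmax hon hspan hwalk using hB
  have hcolC : ∀ q k, (col q k : H →ₗ[ℂ] H) ∈ component V (comp q) := fun q k =>
    (hmax q).1 (Finset.mem_image_of_mem _ (Finset.mem_univ k))
  have hfix : ∀ q i, (col q (k₁ q) : H →ₗ[ℂ] H) (B.e q i (k₁ q)) = B.e q i (k₁ q) := by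
    intro q i
    have hm : B.e q i (k₁ q) ∈ LinearMap.range (col q (k₁ q) : H →ₗ[ℂ] H) := by
      rw [← hspan q]
      exact Submodule.subset_span ⟨i, rfl⟩
    obtain ⟨x, hx⟩ := hm
    rw [← hx, ← Module.End.mul_apply, (hp.proj _ (col q (k₁ q)).2).isIdempotentElem.eq]
  -- The distinguished column is brought into the same form by the trivial walk, whose path isometry
  -- is the projection that fixes its basis.
  have hw : ∀ q k, ∃ w : (graph V).Walk (col q k) (col q (k₁ q)),
      ∀ i, B.e q i k = pathIsometry w (B.e q i (k₁ q)) := by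
    intro q k
    by_cases hk : k = k₁ q
    · subst hk
      exact ⟨SimpleGraph.Walk.nil, fun i => by rw [pathIsometry_nil, hfix]⟩
    · exact hwalk q k hk
  choose w hw using hw
  have hconj : ∀ {q r} k l (T : H →ₗ[ℂ] H),
      star (pathIsometry (w q k)) * ((col q k : H →ₗ[ℂ] H) * T * col r l) * pathIsometry (w r l) =
        star (pathIsometry (w q k)) * T * pathIsometry (w r l) := by
    intro q r k l T
    conv_rhs => rw [← hp.star_pathIsometry_mul_left (w q k), ← hp.mul_pathIsometry (w r l)]
    simp only [mul_assoc]
  have hdisj : ∀ T ∈ A, ∀ {q r} k l, q ≠ r →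
      star (pathIsometry (w q k)) * T * pathIsometry (w r l) = 0 := by
    intro T hT q r k l hqr
    rw [← hconj, hp.conj_eq_zero_of_component_ne hT (fun e => hqr (comp.injective e)) (hcolC q k)
      (hcolC r l), mul_zero, zero_mul]
  have hzero : ∀ {q r} k l, (col q k : H →ₗ[ℂ] H) * col r l = 0 →
      star (pathIsometry (w q k)) * pathIsometry (w r l) = 0 := by
    intro q r k l h0
    have := hconj k l (1 : H →ₗ[ℂ] H)
    rw [mul_one, mul_one, h0, mul_zero, zero_mul] at this
    exact this.symm
  refine ⟨fun q k => pathIsometry (w q k), fun q => col q (k₁ q), fun q i => B.e q i (k₁ q),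
    fun q k => hp.pathIsometry_mem _, fun q k => hp.pathIsometry_mul _,
    fun q k => hp.star_pathIsometry_mul _, ?_, ?_, ?_, hdisj, ?_, hon, hspan, fun q i k => hw q k i,
    ?_⟩
  · intro q k l hkl
    apply hzero
    exact (hmax q).2.1 (Finset.mem_image_of_mem _ (Finset.mem_univ k))
      (Finset.mem_image_of_mem _ (Finset.mem_univ l))
      fun e => hkl (hinj q (Subtype.ext e))
  · intro q r k l hqr
    apply hzero
    apply hp.mul_eq_zero_of_not_mem_component (col q k).2 (hcolC r l)
    intro hm
    obtain ⟨hm', he⟩ := mem_component.1 hm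
    obtain ⟨hm'', he'⟩ := mem_component.1 (hcolC q k)
    exact hqr (comp.injective (he'.symm.trans he))
  · intro T hT q k l
    -- The sandwiched operator lies in `A` and is already compressed to the minimal projection `E
    -- q`.
    obtain ⟨c, hc⟩ := h.minimal _ (col q (k₁ q)).2 (star (pathIsometry (w q k)) * T *
      pathIsometry (w q l)) (mul_mem (mul_mem (star_mem (hp.pathIsometry_mem _)) hT)
        (hp.pathIsometry_mem _))
    refine ⟨c, ?_⟩
    rw [← hc]
    simp only [mul_assoc]
    rw [hp.pathIsometry_mul, ← mul_assoc (col q (k₁ q) : H →ₗ[ℂ] H), hp.mul_star_pathIsometry]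
  · have hsum : ∀ q, ∑ k, pathIsometry (w q k) * star (pathIsometry (w q k)) =
        sumAll (Finset.univ.image fun k => (col q k : H →ₗ[ℂ] H)) := by
      intro q
      rw [sumAll, Finset.sum_image fun k _ l _ e => hinj q (Subtype.ext e)]
      exact Finset.sum_congr rfl fun k _ => hp.pathIsometry_mul_star _
    intro T hT
    rw [← h.adjoin_eq] at hT
    refine mul_eq_self_of_mem_adjoin (fun R hR => ?_) (fun R hR => (h.proj R hR).isSelfAdjoint) hT
    rw [Finset.sum_mul]
    -- On a generator only the block of its own component acts; there the columns add up to a unit,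
    -- whatever largest orthogonal set was chosen.
    obtain ⟨q, hq⟩ := comp.surjective ((graph V).connectedComponentMk ⟨R, hR⟩)
    have hRq : R ∈ component V (comp q) := mem_component.2 ⟨hR, hq.symm⟩
    rw [Finset.sum_eq_single q, hsum, h.sumAll_mul_of_isMaxIndependentSet (hmax q) hRq]
    · intro r _ hr
      rw [hsum, sumAll, Finset.sum_image fun k _ l _ e => hinj r (Subtype.ext e), Finset.sum_mul]
      refine Finset.sum_eq_zero fun k _ => ?_
      apply hp.mul_eq_zero_of_not_mem_component (col r k).2 hRq
      intro hm
      obtain ⟨hm', he⟩ := mem_component.1 hm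
      obtain ⟨hm'', he'⟩ := mem_component.1 (hcolC r k)
      exact hr (comp.injective (he'.symm.trans he))
    · exact fun hn => absurd (Finset.mem_univ q) hn
  · intro q
    refine ⟨?_, (Nat.zero_le _).trans_lt (k₁ q).2⟩
    by_contra h0
    have : IsEmpty (Fin (B.rows q)) := by
      rw [Nat.eq_zero_of_not_pos h0]
      infer_instance
    have := hspan q
    rw [Set.range_eq_empty, Submodule.span_empty] at this
    exact h.ne_zero _ (col q (k₁ q)).2 (LinearMap.range_eq_bot.1 this.symm)

end Construct

/-! ### The model space -/

/-- The index type of the entries of a table. -/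
abbrev BPT.Index (B : BPT H) : Type := (q : Fin B.blocks) × (Fin (B.rows q) × Fin (B.cols q))

theorem BPT.orthonormal_productVector (B : BPT H) :
    Orthonormal ℂ (fun x : B.Index => B.productVector x.1 x.2.1 x.2.2) := by
  rw [orthonormal_iff_ite]
  rintro ⟨q, i, k⟩ ⟨r, j, l⟩
  rw [PiLp.inner_apply]
  by_cases hqr : q = r
  · subst hqr
    rw [Finset.sum_eq_single q]
    · simp only [productVector, Pi.single_eq_same, TensorProduct.inner_tmul,
        EuclideanSpace.inner_single_left, PiLp.single_apply, Sigma.mk.injEq, heq_eq_eq,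
        Prod.mk.injEq, true_and, map_one, one_mul]
      split_ifs <;> simp_all
    · intro s _ hs
      simp [productVector, hs]
    · exact fun h => absurd (Finset.mem_univ q) h
  · rw [if_neg (fun h => hqr (Sigma.mk.inj_iff.1 h).1)]
    refine Finset.sum_eq_zero fun s _ => ?_
    by_cases hs : s = q
    · subst hs
      simp [productVector, hqr]
    · simp [productVector, hs]

theorem BPT.span_productVector (B : BPT H) :
    Submodule.span ℂ (Set.range fun x : B.Index => B.productVector x.1 x.2.1 x.2.2) = ⊤ := by
  let b := (Pi.basis fun q : Fin B.blocks =>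
    (EuclideanSpace.basisFun (Fin (B.rows q)) ℂ).toBasis.tensorProduct
      (EuclideanSpace.basisFun (Fin (B.cols q)) ℂ).toBasis).map
    (WithLp.linearEquiv 2 ℂ _).symm
  have hb : (fun x : B.Index => B.productVector x.1 x.2.1 x.2.2) = b := by
    funext x
    simp [b, productVector, Module.Basis.tensorProduct_apply']
  rw [hb]
  exact b.span_eq

/-- The orthonormal basis of product vectors. -/
def BPT.productBasis (B : BPT H) : OrthonormalBasis B.Index ℂ B.Space :=
  OrthonormalBasis.mk B.orthonormal_productVector B.span_productVector.ge

@[simp] theorem BPT.productBasis_apply (B : BPT H) (x : B.Index) :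
    B.productBasis x = B.productVector x.1 x.2.1 x.2.2 := by
  rw [productBasis, OrthonormalBasis.coe_mk]

/-- `BPT.blockOp` as a linear map. -/
def BPT.blockOpLin (B : BPT H)
    (M : (q : Fin B.blocks) →
      EuclideanSpace ℂ (Fin (B.cols q)) →ₗ[ℂ] EuclideanSpace ℂ (Fin (B.cols q))) :
    B.Space →ₗ[ℂ] B.Space :=
  (WithLp.linearEquiv 2 ℂ _).symm.toLinearMap ∘ₗ
    (LinearMap.pi fun q => (M q).lTensor (EuclideanSpace ℂ (Fin (B.rows q))) ∘ₗ
      LinearMap.proj q) ∘ₗ (WithLp.linearEquiv 2 ℂ _).toLinearMap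

theorem BPT.blockOp_productVector (B : BPT H)
    (M : (q : Fin B.blocks) →
      EuclideanSpace ℂ (Fin (B.cols q)) →ₗ[ℂ] EuclideanSpace ℂ (Fin (B.cols q)))
    (q : Fin B.blocks) (i : Fin (B.rows q)) (k : Fin (B.cols q)) :
    B.blockOp M (B.productVector q i k) =
      ∑ l, (M q (EuclideanSpace.single k 1)) l • B.productVector q i l := by
  have h1 : M q (EuclideanSpace.single k 1) =
      ∑ l, (M q (EuclideanSpace.single k 1)) l • EuclideanSpace.single l (1 : ℂ) := by
    ext j
    simp [Pi.single_apply]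
  ext r
  rw [WithLp.ofLp_sum, Finset.sum_apply]
  by_cases hr : r = q
  · subst hr
    simp only [blockOp, productVector, Pi.single_eq_same, LinearMap.lTensor_tmul, WithLp.ofLp_smul,
      Pi.smul_apply]
    conv_lhs => rw [h1]
    simp [TensorProduct.tmul_sum, TensorProduct.tmul_smul]
  · simp [blockOp, productVector, hr]

/-! ### Irrep frames realise the irrep decomposition -/

section Frame

variable {A : NonUnitalStarSubalgebra ℂ (H →ₗ[ℂ] H)} {B : BPT H}
  {U : (q : Fin B.blocks) → Fin (B.cols q) → H →ₗ[ℂ] H} {E : Fin B.blocks → H →ₗ[ℂ] H}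
  {f : (q : Fin B.blocks) → Fin (B.rows q) → H}

theorem mem_nullSpace {x : H} : x ∈ nullSpace A ↔ ∀ T ∈ A, T x = 0 := by
  simp [nullSpace, Submodule.mem_iInf]

/-- The operator on `H` that corresponds to `⨁_q I ⊗ M q`. -/
def frameOp (U : (q : Fin B.blocks) → Fin (B.cols q) → H →ₗ[ℂ] H)
    (M : (q : Fin B.blocks) →
      EuclideanSpace ℂ (Fin (B.cols q)) →ₗ[ℂ] EuclideanSpace ℂ (Fin (B.cols q))) : H →ₗ[ℂ] H :=
  ∑ q, ∑ l, ∑ k, (M q (EuclideanSpace.single k 1)) l • (U q l * star (U q k))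

namespace IsIrrepFrame

variable (h : IsIrrepFrame A B U E f)
include h

theorem apply_proj (q : Fin B.blocks) (i : Fin (B.rows q)) : E q (f q i) = f q i := by
  obtain ⟨x, hx⟩ : f q i ∈ LinearMap.range (E q) := by
    rw [← h.span_eq]
    exact Submodule.subset_span ⟨i, rfl⟩
  obtain ⟨k⟩ : Nonempty (Fin (B.cols q)) := ⟨⟨0, (h.pos q).2⟩⟩
  have hE : E q * E q = E q := by
    have : star (U q k) * U q k * E q = star (U q k) * U q k := by rw [mul_assoc, h.mul_proj]
    rwa [h.star_mul_self] at this
  rw [← hx, ← Module.End.mul_apply, hE]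

theorem star_apply (q : Fin B.blocks) (k l : Fin (B.cols q)) (i : Fin (B.rows q)) :
    star (U q k) (B.e q i l) = if k = l then f q i else 0 := by
  rw [h.apply_eq, ← Module.End.mul_apply]
  split_ifs with hkl
  · subst hkl
    rw [h.star_mul_self, h.apply_proj]
  · rw [h.star_mul_of_ne q hkl, LinearMap.zero_apply]

theorem star_apply_of_block_ne {q r : Fin B.blocks} (k : Fin (B.cols q)) (l : Fin (B.cols r))
    (i : Fin (B.rows r)) (hqr : q ≠ r) : star (U q k) (B.e r i l) = 0 := by
  rw [h.apply_eq, ← Module.End.mul_apply, h.star_mul_of_block_ne k l hqr, LinearMap.zero_apply]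

theorem orthonormal_e : Orthonormal ℂ (fun x : B.Index => B.e x.1 x.2.1 x.2.2) := by
  rw [orthonormal_iff_ite]
  rintro ⟨q, i, k⟩ ⟨r, j, l⟩
  change inner ℂ (B.e q i k) (B.e r j l) = _
  rw [h.apply_eq q i k, ← LinearMap.adjoint_inner_right, ← LinearMap.star_eq_adjoint]
  by_cases hqr : q = r
  · subst hqr
    rw [h.star_apply]
    have ho := orthonormal_iff_ite.1 (h.orthonormal q) i j
    by_cases hkl : k = l
    · subst hkl
      rw [if_pos rfl, ho]
      simp
    · rw [if_neg hkl, inner_zero_right, if_neg]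
      simp [hkl]
  · rw [h.star_apply_of_block_ne k l j hqr, inner_zero_right,
      if_neg (fun h => hqr (Sigma.mk.inj_iff.1 h).1)]

theorem e_mem_orthogonal (q : Fin B.blocks) (i : Fin (B.rows q)) (k : Fin (B.cols q)) :
    B.e q i k ∈ (nullSpace A)ᗮ := by
  rw [Submodule.mem_orthogonal]
  intro x hx
  rw [h.apply_eq, ← LinearMap.adjoint_inner_left, ← LinearMap.star_eq_adjoint,
    mem_nullSpace.1 hx _ (star_mem (h.mem q k)), inner_zero_left]

theorem sum_mul_star_apply_mem_span (x : H) : (∑ q, ∑ k, U q k * star (U q k)) x ∈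
    Submodule.span ℂ (Set.range fun x : B.Index => B.e x.1 x.2.1 x.2.2) := by
  simp only [LinearMap.sum_apply]
  refine sum_mem fun q _ => sum_mem fun k _ => ?_
  rw [← h.mul_proj q k, mul_assoc, Module.End.mul_apply, Module.End.mul_apply]
  have hle : Submodule.span ℂ (Set.range (f q)) ≤
      (Submodule.span ℂ (Set.range fun x : B.Index => B.e x.1 x.2.1 x.2.2)).comap (U q k) := by
    rw [Submodule.span_le]
    rintro _ ⟨i, rfl⟩
    exact Submodule.subset_span ⟨⟨q, i, k⟩, h.apply_eq q i k⟩
  apply hle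
  rw [h.span_eq]
  exact ⟨_, rfl⟩

theorem mul_sum_mul_star {T : H →ₗ[ℂ] H} (hT : T ∈ A) :
    T * (∑ q, ∑ k, U q k * star (U q k)) = T := by
  have := congrArg star (h.unit _ (star_mem hT))
  simpa [star_sum] using this

theorem span_e : Submodule.span ℂ (Set.range fun x : B.Index => B.e x.1 x.2.1 x.2.2) =
    (nullSpace A)ᗮ := by
  have hle : Submodule.span ℂ (Set.range fun x : B.Index => B.e x.1 x.2.1 x.2.2) ≤
      (nullSpace A)ᗮ := by
    rw [Submodule.span_le]
    rintro _ ⟨⟨q, i, k⟩, rfl⟩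
    exact h.e_mem_orthogonal q i k
  refine le_antisymm hle ?_
  · intro x hx
    set J := ∑ q, ∑ k, U q k * star (U q k) with hJ
    have hJx := h.sum_mul_star_apply_mem_span x
    have h1 : x - J x ∈ (nullSpace A)ᗮ := sub_mem hx (hle hJx)
    -- `J` is also a right unit of `A`, so every `T ∈ A` kills `x - J x`. This vector then lies both
    -- in the null space and in its orthogonal complement.
    have h2 : x - J x ∈ nullSpace A := mem_nullSpace.2 fun T hT => by
      rw [map_sub, ← Module.End.mul_apply, h.mul_sum_mul_star hT, sub_self]
    have h3 : x - J x = 0 := by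
      rw [← inner_self_eq_zero (𝕜 := ℂ)]
      exact (Submodule.mem_orthogonal _ _).1 h1 _ h2
    rw [sub_eq_zero.1 h3]
    exact hJx

theorem frameOp_mem (M : (q : Fin B.blocks) →
      EuclideanSpace ℂ (Fin (B.cols q)) →ₗ[ℂ] EuclideanSpace ℂ (Fin (B.cols q))) :
    frameOp U M ∈ A :=
  sum_mem fun q _ => sum_mem fun l _ => sum_mem fun k _ =>
    SMulMemClass.smul_mem _ (mul_mem (h.mem q l) (star_mem (h.mem q k)))

theorem frameOp_apply (M : (q : Fin B.blocks) →
      EuclideanSpace ℂ (Fin (B.cols q)) →ₗ[ℂ] EuclideanSpace ℂ (Fin (B.cols q)))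
    (q : Fin B.blocks) (i : Fin (B.rows q)) (k : Fin (B.cols q)) :
    frameOp U M (B.e q i k) = ∑ l, (M q (EuclideanSpace.single k 1)) l • B.e q i l := by
  simp only [frameOp, LinearMap.sum_apply, LinearMap.smul_apply, Module.End.mul_apply]
  rw [Finset.sum_eq_single q]
  · refine Finset.sum_congr rfl fun l _ => ?_
    rw [Finset.sum_eq_single k]
    · rw [h.star_apply, if_pos rfl, ← h.apply_eq]
    · intro k' _ hk
      rw [h.star_apply, if_neg hk, map_zero, smul_zero]
    · exact fun hn => absurd (Finset.mem_univ k) hn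
  · intro r _ hr
    refine Finset.sum_eq_zero fun l _ => Finset.sum_eq_zero fun k' _ => ?_
    rw [h.star_apply_of_block_ne _ _ _ hr, map_zero, smul_zero]
  · exact fun hn => absurd (Finset.mem_univ q) hn

/-- Inserting the unit `∑ U q k * star (U q k)` on both sides of `T` leaves the terms `U q l * (star
(U q l) * T * U r k) * star (U r k)`. Those with `q ≠ r` vanish by disjointness, and the others are
scalar multiples of matrix units by minimality. -/
theorem exists_eq_frameOp {T : H →ₗ[ℂ] H} (hT : T ∈ A) : ∃ M, T = frameOp U M := by
  choose c hc using h.minimal T hT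
  refine ⟨fun q => (EuclideanSpace.basisFun (Fin (B.cols q)) ℂ).toBasis.constr ℂ
    fun k => WithLp.toLp 2 fun l => c q l k, ?_⟩
  have hM : ∀ q l k, ((EuclideanSpace.basisFun (Fin (B.cols q)) ℂ).toBasis.constr ℂ
      (fun k => WithLp.toLp 2 fun l => c q l k) : _ →ₗ[ℂ] EuclideanSpace ℂ (Fin (B.cols q)))
      (EuclideanSpace.single k 1) l = c q l k := by
    intro q l k
    have : EuclideanSpace.single k (1 : ℂ) =
      (EuclideanSpace.basisFun (Fin (B.cols q)) ℂ).toBasis k := by simp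
    rw [this, Module.Basis.constr_basis]
  simp only [frameOp, hM]
  have key : ∀ q l, U q l * star (U q l) * T = ∑ k, c q l k • (U q l * star (U q k)) := by
    intro q l
    conv_lhs => rw [← h.mul_sum_mul_star hT]
    rw [Finset.mul_sum, Finset.mul_sum, Finset.sum_eq_single q]
    · rw [Finset.mul_sum, Finset.mul_sum]
      refine Finset.sum_congr rfl fun k _ => ?_
      calc U q l * star (U q l) * (T * (U q k * star (U q k))) =
          U q l * (star (U q l) * T * U q k) * star (U q k) := by simp only [mul_assoc]
        _ = _ := by rw [hc, mul_smul_comm, h.mul_proj, smul_mul_assoc]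
    · intro r _ hr
      rw [Finset.mul_sum, Finset.mul_sum]
      refine Finset.sum_eq_zero fun k _ => ?_
      calc U q l * star (U q l) * (T * (U r k * star (U r k))) =
          U q l * (star (U q l) * T * U r k) * star (U r k) := by simp only [mul_assoc]
        _ = 0 := by rw [h.disjoint T hT l k (Ne.symm hr), mul_zero, zero_mul]
    · exact fun hn => absurd (Finset.mem_univ q) hn
  conv_lhs => rw [← h.unit T hT]
  rw [Finset.sum_mul]
  refine Finset.sum_congr rfl fun q _ => ?_
  rw [Finset.sum_mul]
  exact Finset.sum_congr rfl fun l _ => key q l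

/-- The isometry that maps the entries of the table to product vectors and fixes the null space
turns `frameOp U M` into `B.blockOp M`. -/
theorem exists_isometry : ∃ V : H ≃ₗᵢ[ℂ] WithLp 2 (B.Space × nullSpace A),
    (∀ q i k, V (B.e q i k) = WithLp.toLp 2 (B.productVector q i k, 0)) ∧
    (∀ v : nullSpace A, V (v : H) = WithLp.toLp 2 (0, v)) ∧
    ∀ M x, V (frameOp U M x) = WithLp.toLp 2 (B.blockOp M (V x).fst, 0) := by
  let v := stdOrthonormalBasis ℂ (nullSpace A)
  let g : B.Index ⊕ Fin (Module.finrank ℂ (nullSpace A)) → H :=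
    Sum.elim (fun x => B.e x.1 x.2.1 x.2.2) fun j => (v j : H)
  have hg : Orthonormal ℂ g := by
    have h1 := orthonormal_iff_ite.1 h.orthonormal_e
    have h2 := orthonormal_iff_ite.1 v.orthonormal
    have h3 : ∀ (x : B.Index) j, inner ℂ (v j : H) (B.e x.1 x.2.1 x.2.2) = 0 := fun x j =>
      (Submodule.mem_orthogonal _ _).1 (h.e_mem_orthogonal _ _ _) _ (v j).2
    rw [orthonormal_iff_ite]
    rintro (x | i) (y | j)
    · simpa [g] using h1 x y
    · simpa [g] using inner_eq_zero_symm.1 (h3 x j)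
    · simpa [g] using h3 y i
    · simpa [g] using h2 i j
  have hgs : ⊤ ≤ Submodule.span ℂ (Set.range g) := by
    have hv : Submodule.span ℂ (Set.range fun j => (v j : H)) = nullSpace A := by
      have h1 : Set.range (fun j => (v j : H)) = (nullSpace A).subtype '' Set.range v := by
        rw [← Set.range_comp]; rfl
      have h2 := v.toBasis.span_eq
      rw [v.coe_toBasis] at h2
      rw [h1, ← Submodule.map_span, h2, Submodule.map_top, Submodule.range_subtype]
    rw [Set.Sum.elim_range, Submodule.span_union, h.span_e, hv, sup_comm,
      Submodule.sup_orthogonal_of_hasOrthogonalProjection]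
  let b := OrthonormalBasis.mk hg hgs
  let b' := B.productBasis.prod v
  let V := b.equiv b' (Equiv.refl _)
  have hV : ∀ i, V (g i) = b' i := by
    intro i
    have : g i = b i := by rw [OrthonormalBasis.coe_mk]
    rw [this, OrthonormalBasis.equiv_apply_basis, Equiv.refl_apply]
  have hVe : ∀ q i k, V (B.e q i k) = WithLp.toLp 2 (B.productVector q i k, 0) := by
    intro q i k
    have := hV (Sum.inl ⟨q, i, k⟩)
    simpa [g, b'] using this
  have hVv : ∀ x : nullSpace A, V (x : H) = WithLp.toLp 2 (0, x) := by
    have : V.toLinearEquiv.toLinearMap ∘ₗ (nullSpace A).subtype =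
        (WithLp.linearEquiv 2 ℂ (B.Space × nullSpace A)).symm.toLinearMap ∘ₗ
          LinearMap.inr ℂ B.Space (nullSpace A) := by
      refine v.toBasis.ext fun j => ?_
      have := hV (Sum.inr j)
      simpa [g, b'] using this
    intro x
    exact LinearMap.congr_fun this x
  refine ⟨V, hVe, hVv, fun M => ?_⟩
  -- Both sides are linear, so they are compared on the basis: table entries go to the corresponding
  -- columns of `M`, and null vectors go to zero because `frameOp U M` lies in `A`.
  have : V.toLinearEquiv.toLinearMap ∘ₗ frameOp U M =
      (WithLp.linearEquiv 2 ℂ (B.Space × nullSpace A)).symm.toLinearMap ∘ₗ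
        LinearMap.inl ℂ B.Space (nullSpace A) ∘ₗ B.blockOpLin M ∘ₗ
        LinearMap.fst ℂ B.Space (nullSpace A) ∘ₗ
        (WithLp.linearEquiv 2 ℂ (B.Space × nullSpace A)).toLinearMap ∘ₗ
        V.toLinearEquiv.toLinearMap := by
    refine b.toBasis.ext fun j => ?_
    rw [b.coe_toBasis, OrthonormalBasis.coe_mk]
    rcases j with ⟨q, i, k⟩ | j
    · change V (frameOp U M (B.e q i k)) =
        WithLp.toLp 2 (B.blockOp M (V (B.e q i k)).fst, 0)
      rw [h.frameOp_apply, hVe]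
      change _ = ((WithLp.linearEquiv 2 ℂ (B.Space × nullSpace A)).symm.toLinearMap ∘ₗ
        LinearMap.inl ℂ B.Space (nullSpace A)) (B.blockOp M (B.productVector q i k))
      rw [B.blockOp_productVector, map_sum, map_sum]
      refine Finset.sum_congr rfl fun l _ => ?_
      rw [map_smul, map_smul, hVe]
      rfl
    · change V (frameOp U M (v j)) = WithLp.toLp 2 (B.blockOpLin M (V (v j : H)).fst, 0)
      rw [mem_nullSpace.1 (v j).2 _ (h.frameOp_mem M), hVv, map_zero]
      change _ = WithLp.toLp 2 (B.blockOpLin M 0, 0)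
      rw [map_zero]
      rfl
  intro x
  exact LinearMap.congr_fun this x

theorem realisesIrrepDecomposition : RealisesIrrepDecomposition A B := by
  refine ⟨h.pos, h.orthonormal_e, h.span_e, ?_⟩
  obtain ⟨V, hV1, hV2, hV3⟩ := h.exists_isometry
  refine ⟨V, hV1, hV2, fun T => ⟨fun hT => ?_, ?_⟩⟩
  · obtain ⟨M, rfl⟩ := h.exists_eq_frameOp hT
    exact ⟨M, hV3 M⟩
  · rintro ⟨M, hM⟩
    -- An operator is determined by its transform under `V`, so one of block form coincides with the
    -- corresponding element of `A`.
    have : T = frameOp U M := LinearMap.ext fun x => V.injective (by rw [hM, hV3])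
    rw [this]
    exact h.frameOp_mem M

end IsIrrepFrame

end Frame

end

end IrrepDecomp

/-! ### The main theorem -/

theorem mainTheorem1 {H : Type*} [NormedAddCommGroup H] [InnerProductSpace ℂ H]
    [FiniteDimensional ℂ H] (𝓜 : Finset (H →ₗ[ℂ] H)) (h𝓜 : ∀ M ∈ 𝓜, IsSelfAdjoint M) :
    -- the algorithm can be started, and every run of it is finite
    (∃ s, IrrepDecomp.Initial 𝓜 s) ∧
    (¬ ∃ f : ℕ → IrrepDecomp.State H,
      IrrepDecomp.Initial 𝓜 (f 0) ∧ ∀ n, IrrepDecomp.Step (f n) (f (n + 1))) ∧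
    -- it never gets stuck before it has produced an output
    (∀ s, IrrepDecomp.Reachable 𝓜 s →
      (∃ B, s = .output B) ∨ ∃ s', IrrepDecomp.Step s s') ∧
    -- whatever choices are made, the output realises the irrep decomposition
    (∀ B : IrrepDecomp.BPT H, IrrepDecomp.Reachable 𝓜 (.output B) →
      IrrepDecomp.RealisesIrrepDecomposition (NonUnitalStarAlgebra.adjoin ℂ (𝓜 : Set _)) B) := by
  refine ⟨IrrepDecomp.exists_initial 𝓜, IrrepDecomp.not_exists_infinite_run h𝓜,
    fun s hs => IrrepDecomp.not_stuck (hs.invariant h𝓜), fun B hB => ?_⟩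
  obtain ⟨V, hV, hB⟩ := hB.invariant h𝓜
  obtain ⟨U, E, f, hf⟩ := hV.exists_isIrrepFrame hB
  exact hf.realisesIrrepDecomposition
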